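/- Let $T>0$, let $(\Omega,\mathcal A,\mathbb P)$ be a probability space with a filtration $\mathcal F=(\mathcal F_t)_{t\in[0,T]}$, let $W$ be a standard $\mathcal F$-Brownian motion on $[0,T]$, and let $Y$ be an $\mathcal F$-adapted, càdlàg, irreducible time-homogeneous Markov chain on the unit vectors $\{e_1,\dots,e_d\}\subset\mathbb R^d$ with rate matrix $Q$ and invariant initial law. Let $\mu\in\mathbb R^d$ and $\sigma\in\mathbb R^d_{>0}$, and let $$R^{\mathrm{MSM}}_t=\int_0^t\mu^TY_s\,ds+\int_0^t\sigma^TY_s\,dW_s ,\qquad t\in[0,T].$$ Let $\mathcal G=(\mathcal G_t)_{t\in[0,T]}$ be a filtration with $\mathcal G_t\subseteq\mathcal F_t$. Call a jointly measurable real process $v=(v_t)_{t\in[0,T]}$ admissible if it is $\mathcal G$-adapted and lies in the closure in $L^2([0,T]\times\Omega,ds\otimes\mathbb P)$ of the simple $\mathcal F$-adapted processes (finite sums $\sum_k\xi_k\mathbf 1_{(a_k,b_k]}$ with $\xi_k$ bounded and $\mathcal F_{a_k}$-measurable), so that its $L^2$ Itô integral is defined, and put $$R^v_t=\int_0^t\mu^TY_s\,ds+\int_0^tv_s\,dW_s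 .$$ Then: 1. There is an admissible process $\tilde\sigma$ such that $\tilde\sigma_t=\sigma^T\,\mathbb E[Y_t\mid\mathcal G_t]$ almost surely for every $t\in[0,T]$. 2. For every $t\in[0,T]$ and every admissible $v$, the process $v$ minimizes $\mathbb E\big[|R^{\mathrm{MSM}}_t-R^{v}_t|^2\big]$ among all admissible processes if and only if $v_s=\sigma^T\,\mathbb E[Y_s\mid\mathcal G_s]$ almost surely for Lebesgue-almost every $s\in[0,t]$. In particular $\tilde\sigma_t=\sigma^T\,\mathbb E[Y_t\mid\mathcal G_t]$ is, simultaneously for all $t\in[0,T]$, the minimizer of the mean squared error, unique up to $ds\otimes\mathbb P$-null sets. -/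

import Mathlib

open MeasureTheory ProbabilityTheory Filter Topology
open scoped ENNReal NNReal Matrix

/-- `W` is a standard Brownian motion on `[0, T]` relative to the filtration `𝓕`.
Time is indexed by `ℝ`; only the values at times in `[0, T]` matter. -/
structure IsBrownianMotionOn {Ω : Type*} [m : MeasurableSpace Ω] (P : Measure Ω) (T : ℝ)
    (𝓕 : Filtration ℝ m) (W : ℝ → Ω → ℝ) : Prop where
  start : ∀ᵐ ω ∂P, W 0 ω = 0
  adapted : ∀ t ∈ Set.Icc 0 T, Measurable[𝓕 t] (W t)
  law_increment : ∀ s t : ℝ, 0 ≤ s → s ≤ t → t ≤ T →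
    P.map (fun ω => W t ω - W s ω) = gaussianReal 0 (Real.toNNReal (t - s))
  indep_increment : ∀ s t : ℝ, 0 ≤ s → s ≤ t → t ≤ T →
    Indep (MeasurableSpace.comap (fun ω => W t ω - W s ω) inferInstance) (𝓕 s) P
  continuous_paths : ∀ᵐ ω ∂P, ContinuousOn (fun t => W t ω) (Set.Icc 0 T)

/-- `Q` is the rate matrix (generator) of an irreducible continuous-time Markov chain on `d`
states; the transition matrices are `exp (t Q)`. -/
structure IsIrreducibleRateMatrix {d : ℕ} (Q : Matrix (Fin d) (Fin d) ℝ) : Prop where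
  offdiag_nonneg : ∀ i j, i ≠ j → 0 ≤ Q i j
  row_sum : ∀ i, ∑ j, Q i j = 0
  irreducible : ∀ i j, ∃ t : ℝ, 0 ≤ t ∧ 0 < (NormedSpace.exp (t • Q)) i j

/-- `Y` is a time-homogeneous irreducible Markov chain on `[0, T]` with values in the unit vectors
`{e_1, …, e_d}`, rate matrix `Q`, càdlàg paths, and an invariant initial law.
Since `Y` is an indicator vector, the `j`-th coordinate of `E[Y_t | Y_r, r ≤ s]` is the
conditional probability of `Y_t = e_j`, and the `j`-th coordinate of the row vector
`Y_s exp ((t - s) Q)` is the transition probability from `Y_s` to `e_j`. -/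
structure IsStationaryMarkovChain {Ω : Type*} [MeasurableSpace Ω] (P : Measure Ω) (T : ℝ)
    {d : ℕ} (Q : Matrix (Fin d) (Fin d) ℝ) (Y : ℝ → Ω → Fin d → ℝ) : Prop where
  rate : IsIrreducibleRateMatrix Q
  measurable : ∀ t ∈ Set.Icc 0 T, Measurable (Y t)
  unit_vector : ∀ t ∈ Set.Icc 0 T, ∀ ω, ∃ i, Y t ω = Pi.single i 1
  right_continuous : ∀ ω, ∀ t ∈ Set.Ico 0 T,
    ContinuousWithinAt (fun s => Y s ω) (Set.Ici t) t
  left_limit : ∀ ω, ∀ t ∈ Set.Ioc 0 T, ∃ l, Tendsto (fun s => Y s ω) (𝓝[<] t) (𝓝 l)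
  markov : ∀ s t : ℝ, 0 ≤ s → s ≤ t → t ≤ T →
    P[Y t | ⨆ r ∈ Set.Icc 0 s, MeasurableSpace.comap (Y r) inferInstance] =ᵐ[P]
      fun ω => Y s ω ᵥ* NormedSpace.exp ((t - s) • Q)
  initial_invariant : (fun i => P.real {ω | Y 0 ω = Pi.single i 1}) ᵥ* Q = 0

/-- A simple process: a finite sum `∑ ξ_k 1_{(a_k, b_k]}` with `ξ_k` bounded and
`𝓕_{a_k}`-measurable. -/
structure SimpleIntegrand {Ω : Type*} [m : MeasurableSpace Ω] (𝓕 : Filtration ℝ m) where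
  n : ℕ
  left : Fin n → ℝ
  right : Fin n → ℝ
  coeff : Fin n → Ω → ℝ
  left_nonneg : ∀ k, 0 ≤ left k
  left_le_right : ∀ k, left k ≤ right k
  coeff_measurable : ∀ k, Measurable[𝓕 (left k)] (coeff k)
  coeff_bounded : ∀ k, ∃ C : ℝ, ∀ ω, |coeff k ω| ≤ C

namespace SimpleIntegrand

/-- The simple process as a function of time and `ω`. -/
noncomputable def path {Ω : Type*} [m : MeasurableSpace Ω] {𝓕 : Filtration ℝ m}
    (V : SimpleIntegrand 𝓕) (s : ℝ) (ω : Ω) : ℝ :=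
  ∑ k, Set.indicator (Set.Ioc (V.left k) (V.right k)) (fun _ => V.coeff k ω) s

/-- The elementary integral `∫_0^t V dW = ∑ ξ_k (W_{b_k ∧ t} - W_{a_k ∧ t})`. -/
noncomputable def integral {Ω : Type*} [m : MeasurableSpace Ω] {𝓕 : Filtration ℝ m}
    (V : SimpleIntegrand 𝓕) (W : ℝ → Ω → ℝ) (t : ℝ) (ω : Ω) : ℝ :=
  ∑ k, V.coeff k ω * (W (min (V.right k) t) ω - W (min (V.left k) t) ω)

end SimpleIntegrand

/-- `V n → v` in `L²((0, t] × Ω, ds ⊗ P)`. -/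
def ApproximatedBy {Ω : Type*} [m : MeasurableSpace Ω] (P : Measure Ω) {𝓕 : Filtration ℝ m}
    (v : ℝ → Ω → ℝ) (t : ℝ) (V : ℕ → SimpleIntegrand 𝓕) : Prop :=
  Tendsto (fun n => eLpNorm (fun p : ℝ × Ω => (V n).path p.1 p.2 - v p.1 p.2) 2
    ((volume.restrict (Set.Ioc 0 t)).prod P)) atTop (𝓝 0)

/-- `v` is an `L²` Itô integrand on `[0, t]`: it lies in the `L²(ds ⊗ P)`-closure of the
simple processes. -/
def ItoIntegrable {Ω : Type*} [m : MeasurableSpace Ω] (P : Measure Ω) (𝓕 : Filtration ℝ m)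
    (v : ℝ → Ω → ℝ) (t : ℝ) : Prop :=
  ∃ V : ℕ → SimpleIntegrand 𝓕, ApproximatedBy P v t V

/-- `I` is (a version of) the Itô integral `∫_0^t v dW`: the `L²(P)`-limit of the elementary
integrals of simple processes that converge to `v` in `L²(ds ⊗ P)`. -/
def IsItoIntegral {Ω : Type*} [m : MeasurableSpace Ω] (P : Measure Ω) (𝓕 : Filtration ℝ m)
    (W : ℝ → Ω → ℝ) (v : ℝ → Ω → ℝ) (t : ℝ) (I : Ω → ℝ) : Prop :=
  MemLp I 2 P ∧ ∃ V : ℕ → SimpleIntegrand 𝓕, ApproximatedBy P v t V ∧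
    Tendsto (fun n => eLpNorm (fun ω => (V n).integral W t ω - I ω) 2 P) atTop (𝓝 0)

open Classical in
/-- The Itô integral `∫_0^t v dW` (a version of it; `0` if there is none). -/
noncomputable def itoIntegral {Ω : Type*} [m : MeasurableSpace Ω] (P : Measure Ω)
    (𝓕 : Filtration ℝ m) (W : ℝ → Ω → ℝ) (v : ℝ → Ω → ℝ) (t : ℝ) : Ω → ℝ :=
  if h : ∃ I, IsItoIntegral P 𝓕 W v t I then h.choose else 0

/-- The return `R_t = ∫_0^t μᵀ Y_s ds + ∫_0^t v_s dW_s` of the model with volatility `v`. -/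
noncomputable def returnProcess {Ω : Type*} [m : MeasurableSpace Ω] (P : Measure Ω)
    (𝓕 : Filtration ℝ m) (W : ℝ → Ω → ℝ) {d : ℕ} (Y : ℝ → Ω → Fin d → ℝ) (μ : Fin d → ℝ)
    (v : ℝ → Ω → ℝ) (t : ℝ) (ω : Ω) : ℝ :=
  (∫ s in (0 : ℝ)..t, μ ⬝ᵥ Y s ω) + itoIntegral P 𝓕 W v t ω

/-- The return process of the Markov switching model: the volatility is `σᵀ Y`. -/
noncomputable def msmReturn {Ω : Type*} [m : MeasurableSpace Ω] (P : Measure Ω)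
    (𝓕 : Filtration ℝ m) (W : ℝ → Ω → ℝ) {d : ℕ} (Y : ℝ → Ω → Fin d → ℝ) (μ σ : Fin d → ℝ)
    (t : ℝ) (ω : Ω) : ℝ :=
  returnProcess P 𝓕 W Y μ (fun s ω => σ ⬝ᵥ Y s ω) t ω

/-- The mean squared error `E |R^MSM_t - R^v_t|²`. -/
noncomputable def meanSquaredError {Ω : Type*} [m : MeasurableSpace Ω] (P : Measure Ω)
    (𝓕 : Filtration ℝ m) (W : ℝ → Ω → ℝ) {d : ℕ} (Y : ℝ → Ω → Fin d → ℝ) (μ σ : Fin d → ℝ)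
    (v : ℝ → Ω → ℝ) (t : ℝ) : ℝ :=
  ∫ ω, |msmReturn P 𝓕 W Y μ σ t ω - returnProcess P 𝓕 W Y μ v t ω| ^ 2 ∂P

/-- Volatility processes that are observable given the information `𝒢`: jointly measurable,
`𝒢`-adapted on `[0, T]`, and with a square integrable Itô integral on `[0, T]`. -/
structure IsAdmissibleVolatility {Ω : Type*} [m : MeasurableSpace Ω] (P : Measure Ω) (T : ℝ)
    (𝓕 𝒢 : Filtration ℝ m) (v : ℝ → Ω → ℝ) : Prop where
  measurable : Measurable (fun p : ℝ × Ω => v p.1 p.2)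
  adapted : ∀ t ∈ Set.Icc 0 T, Measurable[𝒢 t] (v t)
  itoIntegrable : ItoIntegrable P 𝓕 v T

set_option linter.unusedSectionVars false

/-! Write Z = σᵀY. The drift cancels in R^MSM − R^v, so the Itô isometry turns the error at time t
into the squared distance of Z and v in L²((0, t] × Ω) (`meanSquaredError_eq`). For almost every s,
v_s is square integrable and 𝒢_s-measurable, so Pythagoras for the projection E[· | 𝒢_s] applies
(`integral_prod_sub_sq_eq_add`). If u is an admissible version of s ↦ E[Z_s | 𝒢_s], the error of v
is the error of u plus ‖u − v‖². Hence v is optimal exactly when v = u almost everywhere on (0, t].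

The real work is to build u: the filtrations are not assumed right continuous or complete, so no
optional projection theorem is used. Its place is taken by L²-continuity off a countable set of
times. For fixed f, the second moment of E[f | 𝒢_t] is monotone in t and its increments are squared
L²-distances, so t ↦ E[f | 𝒢_t] is L²-continuous where that moment has no jump. The transition
matrices exp(hQ) tend to the identity, so Z is uniformly L²-continuous; approximating Z_t by Z_q
with q rational carries the property over to E[Z_t | 𝒢_t]
(`exists_countable_tendsto_eLpNorm_optional_sub`).

Such a process, if bounded and adapted, has a jointly measurable adapted modification, the almost
sure limit of its values at countably many earlier times (`exists_measurable_adapted_modification`).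
Its left-point step processes converge to it in L²(ds ⊗ P), since the exceptional times are a null
set (`itoIntegrable_of_tendsto_eLpNorm`). -/

theorem eLpNorm_two_eq_ofReal_sqrt_integral_sq {α : Type*} [MeasurableSpace α] {μ : Measure α}
    {f : α → ℝ} (hf : MemLp f 2 μ) : eLpNorm f 2 μ = ENNReal.ofReal √(∫ x, f x ^ 2 ∂μ) := by
  rw [hf.eLpNorm_eq_integral_rpow_norm (by norm_num) (by norm_num), Real.sqrt_eq_rpow]
  norm_num

theorem eLpNorm_two_eq_of_integral_sq_eq {α β : Type*} [MeasurableSpace α] [MeasurableSpace β]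
    {μ : Measure α} {ν : Measure β} {f : α → ℝ} {g : β → ℝ} (hf : MemLp f 2 μ) (hg : MemLp g 2 ν)
    (h : ∫ x, f x ^ 2 ∂μ = ∫ x, g x ^ 2 ∂ν) : eLpNorm f 2 μ = eLpNorm g 2 ν := by
  rw [eLpNorm_two_eq_ofReal_sqrt_integral_sq hf, eLpNorm_two_eq_ofReal_sqrt_integral_sq hg, h]

theorem integral_sq_eq_toReal_eLpNorm_sq {α : Type*} [MeasurableSpace α] {μ : Measure α}
    {f : α → ℝ} (hf : MemLp f 2 μ) : ∫ x, f x ^ 2 ∂μ = (eLpNorm f 2 μ).toReal ^ 2 := by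
  rw [eLpNorm_two_eq_ofReal_sqrt_integral_sq hf, ENNReal.toReal_ofReal (Real.sqrt_nonneg _),
    Real.sq_sqrt (integral_nonneg fun x => sq_nonneg _)]

/-! ### Moments of Brownian increments with adapted weights -/

namespace IsBrownianMotionOn

variable {Ω : Type*} [m : MeasurableSpace Ω] {P : Measure Ω} [IsProbabilityMeasure P] {T : ℝ}
  {𝓕 : Filtration ℝ m} {W : ℝ → Ω → ℝ}

theorem measurable (hW : IsBrownianMotionOn P T 𝓕 W) {t : ℝ} (h0 : 0 ≤ t) (hT : t ≤ T) :
    Measurable (W t) :=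
  (hW.adapted t ⟨h0, hT⟩).mono (𝓕.le t) le_rfl

theorem measurable_increment (hW : IsBrownianMotionOn P T 𝓕 W) {s t : ℝ} (h0 : 0 ≤ s)
    (hst : s ≤ t) (hT : t ≤ T) : Measurable fun ω => W t ω - W s ω :=
  (hW.measurable (h0.trans hst) hT).sub (hW.measurable h0 (hst.trans hT))

theorem measurable_increment_filtration (hW : IsBrownianMotionOn P T 𝓕 W) {s t u : ℝ} (h0 : 0 ≤ s)
    (hst : s ≤ t) (htu : t ≤ u) (hT : u ≤ T) : Measurable[𝓕 u] fun ω => W t ω - W s ω :=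
  ((hW.adapted t ⟨h0.trans hst, htu.trans hT⟩).mono (𝓕.mono htu) le_rfl).sub
    ((hW.adapted s ⟨h0, hst.trans (htu.trans hT)⟩).mono (𝓕.mono (hst.trans htu)) le_rfl)

theorem memLp_increment (hW : IsBrownianMotionOn P T 𝓕 W) {s t : ℝ} (h0 : 0 ≤ s)
    (hst : s ≤ t) (hT : t ≤ T) {p : ℝ≥0∞} (hp : p ≠ ∞) :
    MemLp (fun ω => W t ω - W s ω) p P := by
  have h := memLp_id_gaussianReal' (μ := 0) (v := Real.toNNReal (t - s)) p hp
  rw [← hW.law_increment s t h0 hst hT,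
    memLp_map_measure_iff aestronglyMeasurable_id (hW.measurable_increment h0 hst hT).aemeasurable]
    at h
  exact h

theorem integral_increment (hW : IsBrownianMotionOn P T 𝓕 W) {s t : ℝ} (h0 : 0 ≤ s)
    (hst : s ≤ t) (hT : t ≤ T) : ∫ ω, (W t ω - W s ω) ∂P = 0 := by
  have h := integral_map (μ := P) (hW.measurable_increment h0 hst hT).aemeasurable
    (f := fun x : ℝ => x) aestronglyMeasurable_id
  rw [hW.law_increment s t h0 hst hT, integral_id_gaussianReal] at h
  exact h.symm

theorem integral_increment_sq (hW : IsBrownianMotionOn P T 𝓕 W) {s t : ℝ} (h0 : 0 ≤ s)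
    (hst : s ≤ t) (hT : t ≤ T) : ∫ ω, (W t ω - W s ω) ^ 2 ∂P = t - s := by
  have h := integral_map (μ := P) (hW.measurable_increment h0 hst hT).aemeasurable
    (f := fun x : ℝ => x ^ 2) (by fun_prop)
  rw [hW.law_increment s t h0 hst hT] at h
  rw [← h]
  have hv := variance_id_gaussianReal (μ := 0) (v := Real.toNNReal (t - s))
  rw [variance_eq_integral aemeasurable_id] at hv
  simpa [integral_id_gaussianReal, Real.coe_toNNReal _ (sub_nonneg.2 hst)] using hv

theorem indepFun_increment (hW : IsBrownianMotionOn P T 𝓕 W) {s t : ℝ} (h0 : 0 ≤ s)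
    (hst : s ≤ t) (hT : t ≤ T) {η : Ω → ℝ} (hη : Measurable[𝓕 s] η) :
    IndepFun η (fun ω => W t ω - W s ω) P := by
  rw [IndepFun_iff_Indep]
  exact (indep_of_indep_of_le_right (hW.indep_increment s t h0 hst hT) hη.comap_le).symm

theorem integral_mul_increment (hW : IsBrownianMotionOn P T 𝓕 W) {s t : ℝ} (h0 : 0 ≤ s)
    (hst : s ≤ t) (hT : t ≤ T) {η : Ω → ℝ} (hη : Measurable[𝓕 s] η) :
    ∫ ω, η ω * (W t ω - W s ω) ∂P = 0 := by
  have h := (hW.indepFun_increment h0 hst hT hη).integral_mul_eq_mul_integral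
    (hη.mono (𝓕.le s) le_rfl).aestronglyMeasurable
    (hW.measurable_increment h0 hst hT).aestronglyMeasurable
  rw [hW.integral_increment h0 hst hT, mul_zero] at h
  exact h

theorem integral_mul_increment_sq (hW : IsBrownianMotionOn P T 𝓕 W) {s t : ℝ} (h0 : 0 ≤ s)
    (hst : s ≤ t) (hT : t ≤ T) {η : Ω → ℝ} (hη : Measurable[𝓕 s] η) :
    ∫ ω, η ω * (W t ω - W s ω) ^ 2 ∂P = (∫ ω, η ω ∂P) * (t - s) := by
  have h := ((hW.indepFun_increment h0 hst hT hη).comp measurable_id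
    (measurable_id.pow_const 2)).integral_mul_eq_mul_integral
    (hη.mono (𝓕.le s) le_rfl).aestronglyMeasurable
    ((hW.measurable_increment h0 hst hT).pow_const 2).aestronglyMeasurable
  rw [← hW.integral_increment_sq h0 hst hT]
  exact h

theorem integrable_mul_increment_mul_increment (hW : IsBrownianMotionOn P T 𝓕 W)
    {a b c d : ℝ} (ha : 0 ≤ a) (hab : a ≤ b) (hb : b ≤ T) (hc : 0 ≤ c) (hcd : c ≤ d) (hd : d ≤ T)
    {ζ : Ω → ℝ} (hζ : Measurable ζ) {C : ℝ} (hC : ∀ ω, |ζ ω| ≤ C) :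
    Integrable (fun ω => ζ ω * ((W b ω - W a ω) * (W d ω - W c ω))) P :=
  ((hW.memLp_increment ha hab hb (p := 2) (by simp)).integrable_mul
    (hW.memLp_increment hc hcd hd (p := 2) (by simp))).bdd_mul
    hζ.aestronglyMeasurable (ae_of_all _ hC)

/-- The covariance of two increments weighted by a bounded random variable that is known at the
later of the two left end points. -/
theorem integral_mul_increment_mul_increment (hW : IsBrownianMotionOn P T 𝓕 W)
    {a b c d : ℝ} (ha : 0 ≤ a) (hab : a ≤ b) (hb : b ≤ T) (hac : a ≤ c) (hcd : c ≤ d) (hd : d ≤ T)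
    {ζ : Ω → ℝ} (hζ : Measurable[𝓕 c] ζ) {C : ℝ} (hC : ∀ ω, |ζ ω| ≤ C) :
    ∫ ω, ζ ω * ((W b ω - W a ω) * (W d ω - W c ω)) ∂P
      = (∫ ω, ζ ω ∂P) * max 0 (min b d - c) := by
  have hc : 0 ≤ c := ha.trans hac
  have hζm : Measurable ζ := hζ.mono (𝓕.le c) le_rfl
  rcases le_total b c with hbc | hcb
  · rw [max_eq_left (by linarith [min_le_left b d]), mul_zero]
    have h := hW.integral_mul_increment hc hcd hd
      (hζ.mul (hW.measurable_increment_filtration ha hab hbc (hcd.trans hd)))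
    simpa only [Pi.mul_apply, mul_assoc] using h
  -- W_c − W_a is known at time c, so its product with the later increment has mean zero. The rest
  -- of the two increments splits at min b d, and only the square over the overlap survives.
  · have key : ∫ ω, ζ ω * ((W c ω - W a ω) * (W d ω - W c ω)) ∂P = 0 := by
      have h := hW.integral_mul_increment hc hcd hd
        (hζ.mul (hW.measurable_increment_filtration ha hac le_rfl (hcd.trans hd)))
      simpa only [Pi.mul_apply, mul_assoc] using h
    have hint := hW.integrable_mul_increment_mul_increment ha hac (hcd.trans hd) hc hcd hd hζm hC
    rcases le_total b d with hbd | hdb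
    · rw [min_eq_left hbd, max_eq_right (by linarith)]
      have h1 := hW.integral_mul_increment_sq hc hcb hb hζ
      have h2 : ∫ ω, ζ ω * ((W b ω - W c ω) * (W d ω - W b ω)) ∂P = 0 := by
        have h := hW.integral_mul_increment (hc.trans hcb) hbd hd
          ((hζ.mono (𝓕.mono hcb) le_rfl).mul
            (hW.measurable_increment_filtration hc hcb le_rfl hb))
        simpa only [Pi.mul_apply, mul_assoc] using h
      have hi1 := hW.integrable_mul_increment_mul_increment hc hcb hb hc hcb hb hζm hC
      have hi2 := hW.integrable_mul_increment_mul_increment hc hcb hb (hc.trans hcb) hbd hd hζm hC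
      simp only [← sq] at hi1
      have e := integral_add' hint (hi1.add hi2)
      rw [integral_add' hi1 hi2, key, h1, h2, zero_add, add_zero] at e
      rw [← e]
      refine integral_congr_ae (ae_of_all _ fun ω => ?_)
      simp only [Pi.add_apply]
      ring
    · rw [min_eq_right hdb, max_eq_right (by linarith)]
      have h1 := hW.integral_mul_increment_sq hc hcd hd hζ
      have h2 : ∫ ω, ζ ω * ((W d ω - W c ω) * (W b ω - W d ω)) ∂P = 0 := by
        have h := hW.integral_mul_increment (hc.trans hcd) hdb hb
          ((hζ.mono (𝓕.mono hcd) le_rfl).mul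
            (hW.measurable_increment_filtration hc hcd le_rfl hd))
        simpa only [Pi.mul_apply, mul_assoc] using h
      have hi1 := hW.integrable_mul_increment_mul_increment hc hcd hd hc hcd hd hζm hC
      have hi2 := hW.integrable_mul_increment_mul_increment hc hcd hd (hc.trans hcd) hdb hb hζm hC
      simp only [← sq] at hi1
      have e := integral_add' hint (hi1.add hi2)
      rw [integral_add' hi1 hi2, key, h1, h2, zero_add, add_zero] at e
      rw [← e]
      refine integral_congr_ae (ae_of_all _ fun ω => ?_)
      simp only [Pi.add_apply]
      ring

end IsBrownianMotionOn

/-! ### Simple processes and their Itô isometry -/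

namespace SimpleIntegrand

variable {Ω : Type*} [m : MeasurableSpace Ω] {P : Measure Ω} [IsProbabilityMeasure P] {T : ℝ}
  {𝓕 : Filtration ℝ m} {W : ℝ → Ω → ℝ}

theorem exists_bound (V : SimpleIntegrand 𝓕) : ∃ C : ℝ, ∀ k ω, |V.coeff k ω| ≤ C := by
  choose C hC using V.coeff_bounded
  refine ⟨∑ k, |C k|, fun k ω => (hC k ω).trans ((le_abs_self _).trans ?_)⟩
  exact Finset.single_le_sum (f := fun k => |C k|) (fun _ _ => abs_nonneg _) (Finset.mem_univ k)

theorem measurable_coeff (V : SimpleIntegrand 𝓕) (k : Fin V.n) : Measurable (V.coeff k) :=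
  (V.coeff_measurable k).mono (𝓕.le _) le_rfl

theorem measurable_path (V : SimpleIntegrand 𝓕) :
    Measurable fun p : ℝ × Ω => V.path p.1 p.2 := by
  refine Finset.measurable_sum _ fun k _ => ?_
  have : (fun p : ℝ × Ω => (Set.Ioc (V.left k) (V.right k)).indicator
      (fun _ => V.coeff k p.2) p.1) =
      (Prod.fst ⁻¹' Set.Ioc (V.left k) (V.right k)).indicator fun p => V.coeff k p.2 := by
    ext p
    simp [Set.indicator]
  rw [this]
  exact ((V.measurable_coeff k).comp measurable_snd).indicator (measurable_fst measurableSet_Ioc)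

theorem exists_bound_path (V : SimpleIntegrand 𝓕) : ∃ C : ℝ, ∀ s ω, |V.path s ω| ≤ C := by
  choose C hC using V.coeff_bounded
  refine ⟨∑ k, C k, fun s ω => (Finset.abs_sum_le_sum_abs _ _).trans
    (Finset.sum_le_sum fun k _ => ?_)⟩
  by_cases hs : s ∈ Set.Ioc (V.left k) (V.right k)
  · simpa [hs] using hC k ω
  · simpa [hs] using (abs_nonneg _).trans (hC k ω)

theorem memLp_path (V : SimpleIntegrand 𝓕) (t : ℝ) :
    MemLp (fun p : ℝ × Ω => V.path p.1 p.2) 2 ((volume.restrict (Set.Ioc 0 t)).prod P) := by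
  obtain ⟨C, hC⟩ := V.exists_bound_path
  exact MemLp.of_bound V.measurable_path.aestronglyMeasurable C
    (ae_of_all _ fun p => hC p.1 p.2)

theorem memLp_integral_summand (V : SimpleIntegrand 𝓕) (hW : IsBrownianMotionOn P T 𝓕 W) {t : ℝ}
    (h0 : 0 ≤ t) (hT : t ≤ T) (k : Fin V.n) :
    MemLp (fun ω => V.coeff k ω * (W (min (V.right k) t) ω - W (min (V.left k) t) ω)) 2 P := by
  obtain ⟨C, hC⟩ := V.exists_bound
  exact (hW.memLp_increment (le_min (V.left_nonneg k) h0)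
    (min_le_min_right t (V.left_le_right k)) ((min_le_right _ _).trans hT) (p := 2) (by simp)).mul (p := ∞)
    (memLp_top_of_bound (V.measurable_coeff k).aestronglyMeasurable C (ae_of_all _ (hC k)))

theorem memLp_integral (V : SimpleIntegrand 𝓕) (hW : IsBrownianMotionOn P T 𝓕 W) {t : ℝ}
    (h0 : 0 ≤ t) (hT : t ≤ T) : MemLp (V.integral W t) 2 P :=
  memLp_finsetSum _ fun k _ => V.memLp_integral_summand hW h0 hT k

/-- The Itô side of the isometry, term by term: two increments correlate only over the overlap of
their intervals before t. `integral_indicator_mul_indicator` gives the same value on the ds ⊗ P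
side. The left end points need no truncation at t, because the outer maximum with 0 absorbs the case
where one exceeds t. -/
theorem integral_summand_mul_summand (V : SimpleIntegrand 𝓕) (hW : IsBrownianMotionOn P T 𝓕 W)
    {t : ℝ} (hT : t ≤ T) (k l : Fin V.n) :
    ∫ ω, (V.coeff k ω * (W (min (V.right k) t) ω - W (min (V.left k) t) ω)) *
      (V.coeff l ω * (W (min (V.right l) t) ω - W (min (V.left l) t) ω)) ∂P =
    (∫ ω, V.coeff k ω * V.coeff l ω ∂P) *
      max 0 (min (min (V.right k) t) (min (V.right l) t) - max (V.left k) (V.left l)) := by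
  obtain ⟨C, hC⟩ := V.exists_bound
  wlog hkl : V.left k ≤ V.left l generalizing k l
  · have h := this l k (le_of_not_ge hkl)
    rw [min_comm (min (V.right l) t), max_comm (V.left l)] at h
    simpa only [mul_comm] using h
  rw [max_eq_right hkl]
  rcases le_total (V.left l) t with hlt | htl
  · rw [min_eq_left hlt, min_eq_left (hkl.trans hlt)]
    have h := hW.integral_mul_increment_mul_increment (V.left_nonneg k)
      (le_min (V.left_le_right k) (hkl.trans hlt)) ((min_le_right _ _).trans hT) hkl
      (le_min (V.left_le_right l) hlt) ((min_le_right _ _).trans hT)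
      (((V.coeff_measurable k).mono (𝓕.mono hkl) le_rfl).mul (V.coeff_measurable l))
      (C := C * C) (fun ω => by
        rw [Pi.mul_apply, abs_mul]
        exact mul_le_mul (hC k ω) (hC l ω) (abs_nonneg _) ((abs_nonneg _).trans (hC k ω)))
    simp only [Pi.mul_apply] at h
    rw [← h]
    refine integral_congr_ae (ae_of_all _ fun ω => ?_)
    simp only
    ring
  · rw [min_eq_right htl, min_eq_right (htl.trans (V.left_le_right l)), max_eq_left
      (by linarith [min_le_right (min (V.right k) t) t])]
    simp

theorem integral_indicator_mul_indicator (V : SimpleIntegrand 𝓕) (t : ℝ) (k l : Fin V.n) :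
    ∫ p : ℝ × Ω, (Set.Ioc (V.left k) (V.right k)).indicator (fun _ => V.coeff k p.2) p.1 *
      (Set.Ioc (V.left l) (V.right l)).indicator (fun _ => V.coeff l p.2) p.1
        ∂((volume.restrict (Set.Ioc 0 t)).prod P) =
    (∫ ω, V.coeff k ω * V.coeff l ω ∂P) *
      max 0 (min (min (V.right k) t) (min (V.right l) t) - max (V.left k) (V.left l)) := by
  have h : ∀ p : ℝ × Ω,
      (Set.Ioc (V.left k) (V.right k)).indicator (fun _ => V.coeff k p.2) p.1 *
      (Set.Ioc (V.left l) (V.right l)).indicator (fun _ => V.coeff l p.2) p.1 =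
      (Set.Ioc (V.left k) (V.right k) ∩ Set.Ioc (V.left l) (V.right l)).indicator
        (fun _ => (1 : ℝ)) p.1 * (V.coeff k p.2 * V.coeff l p.2) := by
    intro p
    by_cases h1 : p.1 ∈ Set.Ioc (V.left k) (V.right k) <;>
      by_cases h2 : p.1 ∈ Set.Ioc (V.left l) (V.right l) <;> simp [h1, h2, Set.indicator]
  simp_rw [h]
  rw [integral_prod_mul (fun s => (Set.Ioc (V.left k) (V.right k) ∩
    Set.Ioc (V.left l) (V.right l)).indicator (fun _ => (1 : ℝ)) s)
    (fun ω => V.coeff k ω * V.coeff l ω), mul_comm]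
  congr 1
  rw [integral_indicator_const _ (measurableSet_Ioc.inter measurableSet_Ioc),
    measureReal_restrict_apply (measurableSet_Ioc.inter measurableSet_Ioc), Set.Ioc_inter_Ioc,
    Set.Ioc_inter_Ioc, Real.volume_real_Ioc, smul_eq_mul, mul_one, max_comm]
  congr 2
  · exact inf_inf_distrib_right _ _ _
  · exact sup_eq_left.2 (le_max_of_le_left (V.left_nonneg k))

/-- The Itô isometry for simple processes. -/
theorem eLpNorm_integral (V : SimpleIntegrand 𝓕) (hW : IsBrownianMotionOn P T 𝓕 W) {t : ℝ}
    (h0 : 0 ≤ t) (hT : t ≤ T) :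
    eLpNorm (V.integral W t) 2 P =
      eLpNorm (fun p : ℝ × Ω => V.path p.1 p.2) 2 ((volume.restrict (Set.Ioc 0 t)).prod P) := by
  refine eLpNorm_two_eq_of_integral_sq_eq (V.memLp_integral hW h0 hT) (V.memLp_path t) ?_
  have hL : ∀ k l, Integrable (fun ω =>
      (V.coeff k ω * (W (min (V.right k) t) ω - W (min (V.left k) t) ω)) *
      (V.coeff l ω * (W (min (V.right l) t) ω - W (min (V.left l) t) ω))) P := fun k l => (V.memLp_integral_summand hW h0 hT k).integrable_mul
    (V.memLp_integral_summand hW h0 hT l)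
  have hR : ∀ k, MemLp (fun p : ℝ × Ω => (Set.Ioc (V.left k) (V.right k)).indicator
      (fun _ => V.coeff k p.2) p.1) 2 ((volume.restrict (Set.Ioc 0 t)).prod P) := by
    intro k
    -- A single summand is itself a simple process, so its square integrability is that of a path.
    let U : SimpleIntegrand 𝓕 := ⟨1, fun _ => V.left k, fun _ => V.right k, fun _ => V.coeff k,
      fun _ => V.left_nonneg k, fun _ => V.left_le_right k, fun _ => V.coeff_measurable k,
      fun _ => V.coeff_bounded k⟩
    have := U.memLp_path (P := P) t
    simpa [path, U] using this
  have hRR : ∀ k l, Integrable (fun p : ℝ × Ω =>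
      (Set.Ioc (V.left k) (V.right k)).indicator (fun _ => V.coeff k p.2) p.1 *
      (Set.Ioc (V.left l) (V.right l)).indicator (fun _ => V.coeff l p.2) p.1)
      ((volume.restrict (Set.Ioc 0 t)).prod P) := fun k l => (hR k).integrable_mul (hR l)
  simp only [integral, path, sq, Finset.sum_mul_sum]
  rw [integral_finsetSum _ fun k _ => integrable_finsetSum _ fun l _ => hL k l,
    integral_finsetSum _ fun k _ => integrable_finsetSum _ fun l _ => hRR k l]
  refine Finset.sum_congr rfl fun k _ => ?_
  rw [integral_finsetSum _ fun l _ => hL k l,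
    integral_finsetSum _ fun l _ => hRR k l]
  exact Finset.sum_congr rfl fun l _ => (V.integral_summand_mul_summand hW hT k l).trans
    (V.integral_indicator_mul_indicator t k l).symm

/-- The difference of two simple processes. -/
def diff (U V : SimpleIntegrand 𝓕) : SimpleIntegrand 𝓕 where
  n := U.n + V.n
  left := Fin.append U.left V.left
  right := Fin.append U.right V.right
  coeff := Fin.append U.coeff fun k ω => -V.coeff k ω
  left_nonneg k := by
    refine Fin.addCases (fun i => ?_) (fun i => ?_) k
    · simpa using U.left_nonneg i
    · simpa using V.left_nonneg i
  left_le_right k := by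
    refine Fin.addCases (fun i => ?_) (fun i => ?_) k
    · simpa using U.left_le_right i
    · simpa using V.left_le_right i
  coeff_measurable k := by
    refine Fin.addCases (fun i => ?_) (fun i => ?_) k
    · rw [Fin.append_left, Fin.append_left]
      exact U.coeff_measurable i
    · rw [Fin.append_right, Fin.append_right]
      exact (V.coeff_measurable i).neg
  coeff_bounded k := by
    refine Fin.addCases (fun i => ?_) (fun i => ?_) k
    · simpa using U.coeff_bounded i
    · simpa using V.coeff_bounded i

theorem diff_path (U V : SimpleIntegrand 𝓕) (s : ℝ) (ω : Ω) :
    (U.diff V).path s ω = U.path s ω - V.path s ω := by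
  have h : ∀ k, (Set.Ioc (V.left k) (V.right k)).indicator (fun _ => -V.coeff k ω) s =
      -(Set.Ioc (V.left k) (V.right k)).indicator (fun _ => V.coeff k ω) s := fun k => by
    simp [Set.indicator]; split_ifs <;> simp
  change ∑ k : Fin (U.n + V.n), _ = _
  rw [Fin.sum_univ_add]
  simp [diff, path, h, sub_eq_add_neg]

theorem diff_integral (U V : SimpleIntegrand 𝓕) (t : ℝ) (ω : Ω) :
    (U.diff V).integral W t ω = U.integral W t ω - V.integral W t ω := by
  change ∑ k : Fin (U.n + V.n), _ = _
  rw [Fin.sum_univ_add]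
  simp [diff, integral, sub_eq_add_neg]

theorem eLpNorm_integral_sub_integral (U V : SimpleIntegrand 𝓕)
    (hW : IsBrownianMotionOn P T 𝓕 W) {t : ℝ} (h0 : 0 ≤ t) (hT : t ≤ T) :
    eLpNorm (U.integral W t - V.integral W t) 2 P =
      eLpNorm ((fun p : ℝ × Ω => U.path p.1 p.2) - fun p : ℝ × Ω => V.path p.1 p.2) 2
        ((volume.restrict (Set.Ioc 0 t)).prod P) := by
  have h := (U.diff V).eLpNorm_integral hW h0 hT
  have e : (U.diff V).integral W t = U.integral W t - V.integral W t :=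
    funext fun ω => U.diff_integral V t ω
  rw [e] at h
  simp only [diff_path] at h
  exact h

end SimpleIntegrand

/-! ### The L² Itô integral and the mean squared error -/

theorem tendsto_toLp_of_tendsto_eLpNorm {α : Type*} [MeasurableSpace α] {μ : Measure α}
    {f : ℕ → α → ℝ} {F : α → ℝ} (hf : ∀ n, MemLp (f n) 2 μ) (hF : MemLp F 2 μ)
    (h : Tendsto (fun n => eLpNorm (f n - F) 2 μ) atTop (𝓝 0)) :
    Tendsto (fun n => (hf n).toLp) atTop (𝓝 hF.toLp) :=
  (Lp.tendsto_Lp_iff_tendsto_eLpNorm'' f hf F hF).2 h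

theorem tendsto_eLpNorm_sub_of_tendsto {α : Type*} [MeasurableSpace α] {μ : Measure α}
    {f g : ℕ → α → ℝ} {F G : α → ℝ} (hf : ∀ n, MemLp (f n) 2 μ) (hF : MemLp F 2 μ)
    (hg : ∀ n, MemLp (g n) 2 μ) (hG : MemLp G 2 μ)
    (h : Tendsto (fun n => eLpNorm (f n - F) 2 μ) atTop (𝓝 0))
    (h' : Tendsto (fun n => eLpNorm (g n - G) 2 μ) atTop (𝓝 0)) :
    Tendsto (fun n => eLpNorm (f n - g n) 2 μ) atTop (𝓝 (eLpNorm (F - G) 2 μ)) := by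
  have := (tendsto_toLp_of_tendsto_eLpNorm hf hF h).edist
    (tendsto_toLp_of_tendsto_eLpNorm hg hG h')
  simpa only [Lp.edist_toLp_toLp] using this

theorem memLp_of_eLpNorm_sub_ne_top {α : Type*} [MeasurableSpace α] {μ : Measure α}
    {f F : α → ℝ} (hf : MemLp f 2 μ) (hF : AEStronglyMeasurable F μ)
    (h : eLpNorm (f - F) 2 μ ≠ ∞) : MemLp F 2 μ := by
  have h2 : MemLp (f - F) 2 μ := ⟨hf.1.sub hF, h.lt_top⟩
  simpa using hf.sub h2

section ItoIntegral

variable {Ω : Type*} [m : MeasurableSpace Ω] {P : Measure Ω} [IsProbabilityMeasure P] {T : ℝ}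
  {𝓕 : Filtration ℝ m} {W : ℝ → Ω → ℝ}

theorem ApproximatedBy.memLp {v : ℝ → Ω → ℝ} {t : ℝ} {V : ℕ → SimpleIntegrand 𝓕}
    (h : ApproximatedBy P v t V) (hv : AEStronglyMeasurable (fun p : ℝ × Ω => v p.1 p.2)
      ((volume.restrict (Set.Ioc 0 t)).prod P)) :
    MemLp (fun p : ℝ × Ω => v p.1 p.2) 2 ((volume.restrict (Set.Ioc 0 t)).prod P) := by
  obtain ⟨n, hn⟩ := (h.eventually (gt_mem_nhds ENNReal.zero_lt_top)).exists
  exact memLp_of_eLpNorm_sub_ne_top ((V n).memLp_path t) hv hn.ne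

theorem ItoIntegrable.memLp {v : ℝ → Ω → ℝ} {t : ℝ} (h : ItoIntegrable P 𝓕 v t)
    (hv : AEStronglyMeasurable (fun p : ℝ × Ω => v p.1 p.2)
      ((volume.restrict (Set.Ioc 0 t)).prod P)) :
    MemLp (fun p : ℝ × Ω => v p.1 p.2) 2 ((volume.restrict (Set.Ioc 0 t)).prod P) :=
  h.choose_spec.memLp hv

theorem ItoIntegrable.mono {v : ℝ → Ω → ℝ} {s t : ℝ} (h : ItoIntegrable P 𝓕 v t) (hst : s ≤ t) :
    ItoIntegrable P 𝓕 v s := by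
  obtain ⟨V, hV⟩ := h
  refine ⟨V, tendsto_of_tendsto_of_tendsto_of_le_of_le tendsto_const_nhds hV
    (fun _ => bot_le) fun n => eLpNorm_mono_measure _ ?_⟩
  exact Measure.prod_mono (Measure.restrict_mono (Set.Ioc_subset_Ioc_right hst) le_rfl) le_rfl

/-- The isometry makes the elementary integrals of an approximating sequence Cauchy, and L²(P) is
complete. -/
theorem ItoIntegrable.exists_isItoIntegral {v : ℝ → Ω → ℝ} {t : ℝ} (h : ItoIntegrable P 𝓕 v t)
    (hv : AEStronglyMeasurable (fun p : ℝ × Ω => v p.1 p.2)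
      ((volume.restrict (Set.Ioc 0 t)).prod P))
    (hW : IsBrownianMotionOn P T 𝓕 W) (h0 : 0 ≤ t) (hT : t ≤ T) :
    ∃ I, IsItoIntegral P 𝓕 W v t I := by
  obtain ⟨V, hV⟩ := h
  have hp := (tendsto_toLp_of_tendsto_eLpNorm (fun n => (V n).memLp_path t)
    (hV.memLp hv) hV).cauchySeq
  have hi : CauchySeq fun n => ((V n).memLp_integral hW h0 hT).toLp := by
    rw [EMetric.cauchySeq_iff] at hp ⊢
    intro ε hε
    obtain ⟨N, hN⟩ := hp ε hε
    refine ⟨N, fun k hk l hl => ?_⟩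
    have := hN k hk l hl
    rw [Lp.edist_toLp_toLp] at this ⊢
    rwa [(V k).eLpNorm_integral_sub_integral (V l) hW h0 hT]
  obtain ⟨I, hI⟩ := cauchySeq_tendsto_of_complete hi
  refine ⟨I, Lp.memLp I, V, hV, ?_⟩
  have hI' : Tendsto (fun n => ((V n).memLp_integral hW h0 hT).toLp) atTop
      (𝓝 (Lp.memLp I).toLp) := by simpa using hI
  exact (Lp.tendsto_Lp_iff_tendsto_eLpNorm'' _ _ _ _).1 hI'

theorem ItoIntegrable.isItoIntegral_itoIntegral {v : ℝ → Ω → ℝ} {t : ℝ}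
    (h : ItoIntegrable P 𝓕 v t)
    (hv : AEStronglyMeasurable (fun p : ℝ × Ω => v p.1 p.2)
      ((volume.restrict (Set.Ioc 0 t)).prod P))
    (hW : IsBrownianMotionOn P T 𝓕 W) (h0 : 0 ≤ t) (hT : t ≤ T) :
    IsItoIntegral P 𝓕 W v t (itoIntegral P 𝓕 W v t) := by
  have he := h.exists_isItoIntegral hv hW h0 hT
  rw [itoIntegral, dif_pos he]
  exact he.choose_spec

/-- The Itô isometry for the difference of two integrals. -/
theorem IsItoIntegral.eLpNorm_sub {u v : ℝ → Ω → ℝ} {t : ℝ} {I J : Ω → ℝ}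
    (hI : IsItoIntegral P 𝓕 W u t I) (hJ : IsItoIntegral P 𝓕 W v t J)
    (hu : AEStronglyMeasurable (fun p : ℝ × Ω => u p.1 p.2)
      ((volume.restrict (Set.Ioc 0 t)).prod P))
    (hv : AEStronglyMeasurable (fun p : ℝ × Ω => v p.1 p.2)
      ((volume.restrict (Set.Ioc 0 t)).prod P))
    (hW : IsBrownianMotionOn P T 𝓕 W) (h0 : 0 ≤ t) (hT : t ≤ T) :
    eLpNorm (I - J) 2 P = eLpNorm ((fun p : ℝ × Ω => u p.1 p.2) - fun p : ℝ × Ω => v p.1 p.2) 2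
      ((volume.restrict (Set.Ioc 0 t)).prod P) := by
  obtain ⟨hI2, U, hU, hUI⟩ := hI
  obtain ⟨hJ2, V, hV, hVJ⟩ := hJ
  -- The simple isometry equates the distances of U n and V n on both sides, and distances pass to
  -- the limit. For u = v this shows that the integral depends neither on the approximation nor on
  -- the chosen version.
  have h1 := tendsto_eLpNorm_sub_of_tendsto (fun n => (U n).memLp_integral hW h0 hT) hI2
    (fun n => (V n).memLp_integral hW h0 hT) hJ2 hUI hVJ
  have h2 := tendsto_eLpNorm_sub_of_tendsto (fun n => (U n).memLp_path t) (hU.memLp hu)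
    (fun n => (V n).memLp_path t) (hV.memLp hv) hU hV
  simp only [fun n => (U n).eLpNorm_integral_sub_integral (V n) hW h0 hT] at h1
  exact tendsto_nhds_unique h1 h2

theorem meanSquaredError_eq {d : ℕ} {Y : ℝ → Ω → Fin d → ℝ} {μ σ : Fin d → ℝ}
    {v : ℝ → Ω → ℝ} {t : ℝ} (hσY : ItoIntegrable P 𝓕 (fun s ω => σ ⬝ᵥ Y s ω) t)
    (hσYm : AEStronglyMeasurable (fun p : ℝ × Ω => σ ⬝ᵥ Y p.1 p.2)
      ((volume.restrict (Set.Ioc 0 t)).prod P))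
    (hv : ItoIntegrable P 𝓕 v t)
    (hvm : AEStronglyMeasurable (fun p : ℝ × Ω => v p.1 p.2)
      ((volume.restrict (Set.Ioc 0 t)).prod P))
    (hW : IsBrownianMotionOn P T 𝓕 W) (h0 : 0 ≤ t) (hT : t ≤ T) :
    meanSquaredError P 𝓕 W Y μ σ v t =
      ∫ p : ℝ × Ω, (σ ⬝ᵥ Y p.1 p.2 - v p.1 p.2) ^ 2 ∂((volume.restrict (Set.Ioc 0 t)).prod P) := by
  have h1 := hσY.isItoIntegral_itoIntegral hσYm hW h0 hT
  have h2 := hv.isItoIntegral_itoIntegral hvm hW h0 hT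
  have h := h1.eLpNorm_sub h2 hσYm hvm hW h0 hT
  simp only [meanSquaredError, msmReturn, returnProcess, add_sub_add_left_eq_sub, sq_abs]
  have e1 := integral_sq_eq_toReal_eLpNorm_sq (h1.1.sub h2.1)
  have e2 := integral_sq_eq_toReal_eLpNorm_sq ((hσY.memLp hσYm).sub (hv.memLp hvm))
  rw [h, ← e2] at e1
  exact e1

end ItoIntegral

/-! ### Measurable modifications and Itô integrability -/

/-- The part of the sublevel set off D is relatively closed in S \ D, and the part in D is
countable. -/
theorem measurableSet_le_of_continuousOn_diff_countable {S D : Set ℝ} (hS : MeasurableSet S)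
    (hD : D.Countable) {h : ℝ → ℝ≥0∞} (hh : ContinuousOn h (S \ D)) (ε : ℝ≥0∞) :
    MeasurableSet {t | t ∈ S ∧ h t ≤ ε} := by
  obtain ⟨u, hu, hu'⟩ := continuousOn_iff_isClosed.1 hh (Set.Iic ε) isClosed_Iic
  have e : {t | t ∈ S ∧ h t ≤ ε} =
      (u ∩ (S \ D)) ∪ ({t | t ∈ S ∧ h t ≤ ε} ∩ D) := by
    rw [← hu']
    ext t
    simp only [Set.mem_ofPred_eq, Set.mem_union, Set.mem_inter_iff, Set.mem_preimage, Set.mem_Iic,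
      Set.mem_sdiff]
    tauto
  rw [e]
  exact (hu.measurableSet.inter (hS.diff hD.measurableSet)).union
    (hD.mono Set.inter_subset_right).measurableSet

/-- The L¹ distances are summable, so ∑ |f_k − g| has finite mean and its terms tend to 0 almost
surely. -/
theorem ae_tendsto_of_eLpNorm_sub_le_geometric {Ω : Type*} [MeasurableSpace Ω] {P : Measure Ω}
    [IsProbabilityMeasure P] {f : ℕ → Ω → ℝ} {g : Ω → ℝ}
    (hf : ∀ k, AEStronglyMeasurable (f k) P) (hg : AEStronglyMeasurable g P)
    (h : ∀ k, eLpNorm (f k - g) 2 P ≤ (2⁻¹ : ℝ≥0∞) ^ k) :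
    ∀ᵐ ω ∂P, Tendsto (fun k => f k ω) atTop (𝓝 (g ω)) := by
  have h1 : ∀ k, ∫⁻ ω, ‖f k ω - g ω‖ₑ ∂P ≤ (2⁻¹ : ℝ≥0∞) ^ k := fun k => by
    have := eLpNorm_le_eLpNorm_of_exponent_le (μ := P) (p := 1) (q := 2) (by norm_num)
      ((hf k).sub hg)
    rw [eLpNorm_one_eq_lintegral_enorm] at this
    exact this.trans (h k)
  have hm : ∀ k, AEMeasurable (fun ω => ‖f k ω - g ω‖ₑ) P := fun k => ((hf k).sub hg).enorm
  have h2 : ∫⁻ ω, ∑' k, ‖f k ω - g ω‖ₑ ∂P ≠ ∞ := by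
    rw [lintegral_tsum hm]
    refine ne_top_of_le_ne_top ?_ (ENNReal.tsum_le_tsum h1)
    rw [ENNReal.tsum_geometric]
    norm_num
  filter_upwards [ae_lt_top' (AEMeasurable.tsum hm) h2] with ω hω
  have := ENNReal.tendsto_atTop_zero_of_tsum_ne_top hω.ne
  rw [tendsto_iff_edist_tendsto_0]
  simp only [edist_eq_enorm_sub]
  exact this

/-- A bounded adapted process that is `L²`-continuous off a countable set of times has a jointly
measurable adapted modification. -/
theorem exists_measurable_adapted_modification {Ω : Type*} [m : MeasurableSpace Ω]
    {P : Measure Ω} [IsProbabilityMeasure P] {T : ℝ} {𝒢 : Filtration ℝ m} {X : ℝ → Ω → ℝ} {C : ℝ}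
    (hX : ∀ t ∈ Set.Icc 0 T, Measurable[𝒢 t] (X t)) (hXm : ∀ t, Measurable (X t))
    (hC : ∀ t ω, |X t ω| ≤ C) {D : Set ℝ} (hD : D.Countable)
    (hcont : ∀ t ∈ Set.Icc 0 T \ D,
      Tendsto (fun s => eLpNorm (X s - X t) 2 P) (𝓝[Set.Icc 0 T] t) (𝓝 0)) :
    ∃ v : ℝ → Ω → ℝ, (Measurable fun p : ℝ × Ω => v p.1 p.2) ∧
      (∀ t ∈ Set.Icc 0 T, Measurable[𝒢 t] (v t)) ∧ (∀ t ∈ Set.Icc 0 T, v t =ᵐ[P] X t) ∧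
      ∀ t ω, |v t ω| ≤ C := by
  classical
  have hL : ∀ t, MemLp (X t) 2 P := fun t =>
    MemLp.of_bound (hXm t).aestronglyMeasurable C (ae_of_all _ (hC t))
  have hFc : ContinuousOn (fun t => (hL t).toLp) (Set.Icc 0 T \ D) := fun t ht =>
    ((Lp.tendsto_Lp_iff_tendsto_eLpNorm'' _ hL _ (hL t)).2 (hcont t ht)).mono_left
      (nhdsWithin_mono t Set.sdiff_subset)
  have hsets : ∀ (q : ℝ) (ε : ℝ≥0∞),
      MeasurableSet {t | t ∈ Set.Icc 0 T ∧ eLpNorm (X q - X t) 2 P ≤ ε} := fun q ε => by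
    refine measurableSet_le_of_continuousOn_diff_countable measurableSet_Icc hD ?_ ε
    have : ContinuousOn (fun t => edist (hL q).toLp (hL t).toLp) (Set.Icc 0 T \ D) :=
      fun t ht => tendsto_const_nhds.edist (hFc t ht)
    simpa only [Lp.edist_toLp_toLp] using this
  obtain ⟨q, hq⟩ := (hD.union (Set.countable_range ((↑) : ℚ → ℝ))).exists_eq_range
    ⟨0, Or.inr ⟨0, by simp⟩⟩
  -- The implication makes an index available for every real t, as `Nat.find` requires. The
  -- condition q n ≤ t keeps the approximants 𝒢_t-measurable.
  have hex : ∀ (k : ℕ) (t : ℝ), ∃ n, t ∈ Set.Icc 0 T →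
      (q n ∈ Set.Icc 0 t ∧ eLpNorm (X (q n) - X t) 2 P ≤ (2⁻¹ : ℝ≥0∞) ^ k) := fun k t => by
    by_cases ht : t ∈ Set.Icc 0 T
    swap
    · exact ⟨0, fun h => absurd h ht⟩
    suffices ∃ r ∈ D ∪ Set.range ((↑) : ℚ → ℝ), r ∈ Set.Icc 0 t ∧
        eLpNorm (X r - X t) 2 P ≤ (2⁻¹ : ℝ≥0∞) ^ k by
      obtain ⟨r, hr, hr'⟩ := this
      rw [hq] at hr
      obtain ⟨n, rfl⟩ := hr
      exact ⟨n, fun _ => hr'⟩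
    -- Exceptional and rational times approximate themselves; any other t is a point of
    -- L²-continuity and is approached by rationals from the left.
    by_cases htD : t ∈ D ∪ Set.range ((↑) : ℚ → ℝ)
    · exact ⟨t, htD, ⟨ht.1, le_rfl⟩, by simp⟩
    have ht0 : 0 < t := lt_of_le_of_ne ht.1 fun h => htD (Or.inr ⟨0, by simpa using h⟩)
    have hev := (hcont t ⟨ht, fun h => htD (Or.inl h)⟩).eventually
      (gt_mem_nhds (show (0 : ℝ≥0∞) < 2⁻¹ ^ k from ENNReal.pow_pos (by simp) k))
    obtain ⟨δ, hδ, hball⟩ := Metric.mem_nhdsWithin_iff.1 hev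
    obtain ⟨r, hr1, hr2⟩ := exists_rat_btwn (max_lt ht0 (sub_lt_self t hδ))
    have h1 := max_lt_iff.1 hr1
    refine ⟨r, Or.inr ⟨r, rfl⟩, ⟨h1.1.le, hr2.le⟩, le_of_lt (hball ⟨?_, h1.1.le,
      hr2.le.trans ht.2⟩)⟩
    rw [Metric.mem_ball, Real.dist_eq, abs_lt]
    constructor <;> linarith [h1.2]
  have hpm : ∀ k n, MeasurableSet {t | t ∈ Set.Icc 0 T →
      (q n ∈ Set.Icc 0 t ∧ eLpNorm (X (q n) - X t) 2 P ≤ (2⁻¹ : ℝ≥0∞) ^ k)} := fun k n => by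
    have e : {t | t ∈ Set.Icc 0 T →
        (q n ∈ Set.Icc 0 t ∧ eLpNorm (X (q n) - X t) 2 P ≤ (2⁻¹ : ℝ≥0∞) ^ k)} =
        (Set.Icc 0 T)ᶜ ∪ ({t | q n ∈ Set.Icc 0 t} ∩
          {t | t ∈ Set.Icc 0 T ∧ eLpNorm (X (q n) - X t) 2 P ≤ (2⁻¹ : ℝ≥0∞) ^ k}) := by
      ext t
      simp only [Set.mem_ofPred_eq, Set.mem_union, Set.mem_inter_iff, Set.mem_compl_iff]
      tauto
    rw [e]
    refine measurableSet_Icc.compl.union (MeasurableSet.inter ?_ (hsets _ _))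
    have : {t | q n ∈ Set.Icc 0 t} = {t : ℝ | 0 ≤ q n} ∩ Set.Ici (q n) := by
      ext t
      simp
    rw [this]
    exact (MeasurableSet.const _).inter measurableSet_Ici
  -- Taking the least index makes the choice measurable in t.
  let N : ℕ → ℝ → ℕ := fun k t => Nat.find (hex k t)
  have hN : ∀ k, Measurable (N k) := fun k => measurable_find (hex k) (hpm k)
  have hNs : ∀ k, ∀ t ∈ Set.Icc 0 T, q (N k t) ∈ Set.Icc 0 t ∧
      eLpNorm (X (q (N k t)) - X t) 2 P ≤ (2⁻¹ : ℝ≥0∞) ^ k :=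
    fun k t ht => Nat.find_spec (hex k t) ht
  -- The limsup keeps measurability for every ω and is the limit almost surely; the clamp secures
  -- the bound C everywhere.
  let v : ℝ → Ω → ℝ := fun t ω =>
    max (-C) (min C (limsup (fun k => X (q (N k t)) ω) atTop))
  have hC0 : ∀ ω : Ω, 0 ≤ C := fun ω => (abs_nonneg _).trans (hC 0 ω)
  refine ⟨v, ?_, fun t ht => ?_, fun t ht => ?_, fun t ω => ?_⟩
  · refine measurable_const.max (measurable_const.min (Measurable.limsup fun k => ?_))
    have h1 : Measurable fun p : ℕ × Ω => X (q p.1) p.2 :=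
      measurable_from_prod_countable_right fun n => hXm (q n)
    exact h1.comp (((hN k).comp measurable_fst).prodMk measurable_snd)
  · refine Measurable.max (mδ := 𝒢 t) measurable_const
      (Measurable.min (mδ := 𝒢 t) measurable_const (Measurable.limsup (mδ := 𝒢 t) fun k => ?_))
    have hk := (hNs k t ht).1
    exact (hX _ ⟨hk.1, hk.2.trans ht.2⟩).mono (𝒢.mono hk.2) le_rfl
  · filter_upwards [ae_tendsto_of_eLpNorm_sub_le_geometric
      (fun k => (hXm (q (N k t))).aestronglyMeasurable) (hXm t).aestronglyMeasurable
      fun k => (hNs k t ht).2] with ω hω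
    have hb := abs_le.1 (hC t ω)
    simp only [v]
    rw [hω.limsup_eq, min_eq_right hb.2, max_eq_right hb.1]
  · rw [abs_le]
    exact ⟨le_max_left _ _, max_le (by linarith [hC0 ω]) (min_le_left _ _)⟩

/-- The simple process that freezes `v` at the left end points of a partition of `[0, T]` into
`n + 1` intervals. -/
noncomputable def SimpleIntegrand.ofLeftPoints {Ω : Type*} [m : MeasurableSpace Ω] {𝓕 : Filtration ℝ m} {T : ℝ}
    (hT : 0 < T) {v : ℝ → Ω → ℝ} (hv : ∀ t ∈ Set.Icc 0 T, Measurable[𝓕 t] (v t)) {C : ℝ}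
    (hC : ∀ t ∈ Set.Icc 0 T, ∀ ω, |v t ω| ≤ C) (n : ℕ) : SimpleIntegrand 𝓕 where
  n := n + 1
  left k := k * (T / (n + 1))
  right k := (k + 1) * (T / (n + 1))
  coeff k := v (k * (T / (n + 1)))
  left_nonneg k := by positivity
  left_le_right k := by gcongr; linarith
  coeff_measurable k := hv _ ⟨by positivity, by
    rw [mul_div_assoc', div_le_iff₀ (by positivity), mul_comm]
    gcongr
    exact_mod_cast k.2.le⟩
  coeff_bounded k := ⟨C, hC _ ⟨by positivity, by
    rw [mul_div_assoc', div_le_iff₀ (by positivity), mul_comm]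
    gcongr
    exact_mod_cast k.2.le⟩⟩

theorem SimpleIntegrand.exists_path_ofLeftPoints_eq {Ω : Type*} [m : MeasurableSpace Ω]
    {𝓕 : Filtration ℝ m} {T : ℝ}
    (hT : 0 < T) {v : ℝ → Ω → ℝ} (hv : ∀ t ∈ Set.Icc 0 T, Measurable[𝓕 t] (v t)) {C : ℝ}
    (hC : ∀ t ∈ Set.Icc 0 T, ∀ ω, |v t ω| ≤ C) (n : ℕ) {s : ℝ} (hs : s ∈ Set.Ioc 0 T) :
    ∃ r ∈ Set.Icc 0 T, |r - s| ≤ T / (n + 1) ∧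
      ∀ ω, (SimpleIntegrand.ofLeftPoints hT hv hC n).path s ω = v r ω := by
  set δ : ℝ := T / (n + 1) with hδ
  have hδ0 : 0 < δ := by positivity
  have hn : (n + 1 : ℝ) * δ = T := by rw [hδ]; field_simp
  -- The cells are open on the left, so s lies in cell ⌈s/δ⌉ − 1.
  obtain ⟨j, hj⟩ : ∃ j : ℕ, ⌈s / δ⌉₊ = j + 1 :=
    Nat.exists_eq_succ_of_ne_zero (Nat.ceil_pos.2 (div_pos hs.1 hδ0)).ne'
  have hj1 : s ≤ (j + 1) * δ := by
    have := Nat.le_ceil (s / δ)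
    rw [hj, div_le_iff₀ hδ0] at this
    exact_mod_cast this
  have hj2 : j * δ < s := by
    have := Nat.lt_ceil.1 (show j < ⌈s / δ⌉₊ by omega)
    rwa [lt_div_iff₀ hδ0] at this
  have hjn : j < n + 1 := by
    have : (j : ℝ) * δ < (n + 1 : ℝ) * δ := hj2.trans_le (hs.2.trans_eq hn.symm)
    exact_mod_cast lt_of_mul_lt_mul_right this hδ0.le
  refine ⟨j * δ, ⟨by positivity, hj2.le.trans hs.2⟩, ?_, fun ω => ?_⟩
  · rw [abs_le]
    constructor <;> linarith
  · change ∑ k : Fin (n + 1), (Set.Ioc ((k : ℝ) * δ) ((k + 1) * δ)).indicator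
      (fun _ => v (k * δ) ω) s = _
    rw [Finset.sum_eq_single (⟨j, hjn⟩ : Fin (n + 1))]
    · exact Set.indicator_of_mem (show s ∈ Set.Ioc ((j : ℝ) * δ) ((j + 1) * δ) from ⟨hj2, hj1⟩) _
    · intro k _ hk
      refine Set.indicator_of_notMem (fun h => hk (Fin.ext ?_)) _
      have h1 : (k : ℝ) * δ < (j + 1) * δ := h.1.trans_le hj1
      have h2 : (j : ℝ) * δ < (k + 1) * δ := hj2.trans_le h.2
      have h3 := lt_of_mul_lt_mul_right h1 hδ0.le
      have h4 := lt_of_mul_lt_mul_right h2 hδ0.le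
      norm_cast at h3 h4
      change (k : ℕ) = j
      omega
    · simp

/-- A bounded adapted process that is `L²`-continuous off a countable set of times is an `L²` Itô
integrand. -/
theorem itoIntegrable_of_tendsto_eLpNorm {Ω : Type*} [m : MeasurableSpace Ω]
    {P : Measure Ω} [IsProbabilityMeasure P] {T : ℝ} (hT : 0 < T) {𝓕 : Filtration ℝ m}
    {v : ℝ → Ω → ℝ} {C : ℝ}
    (hv : ∀ t ∈ Set.Icc 0 T, Measurable[𝓕 t] (v t)) (hC : ∀ t ∈ Set.Icc 0 T, ∀ ω, |v t ω| ≤ C)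
    (hvm : AEMeasurable (fun p : ℝ × Ω => v p.1 p.2) ((volume.restrict (Set.Ioc 0 T)).prod P))
    {D : Set ℝ} (hD : D.Countable)
    (hcont : ∀ t ∈ Set.Icc 0 T \ D,
      Tendsto (fun s => eLpNorm (v s - v t) 2 P) (𝓝[Set.Icc 0 T] t) (𝓝 0)) :
    ItoIntegrable P 𝓕 v T := by
  let V := SimpleIntegrand.ofLeftPoints hT hv hC
  refine ⟨V, ?_⟩
  have hpath : ∀ n : ℕ, ∀ s ∈ Set.Ioc 0 T, ∃ r ∈ Set.Icc 0 T, |r - s| ≤ T / (n + 1) ∧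
      ∀ ω, (V n).path s ω = v r ω :=
    fun n _ hs => SimpleIntegrand.exists_path_ofLeftPoints_eq hT hv hC n hs
  have hm : ∀ n, AEMeasurable (fun p : ℝ × Ω => ‖(V n).path p.1 p.2 - v p.1 p.2‖ₑ ^ (2 : ℝ))
      ((volume.restrict (Set.Ioc 0 T)).prod P) := fun n =>
    ((V n).measurable_path.aemeasurable.sub hvm).enorm.pow_const _
  have hinner : ∀ (f g : Ω → ℝ), ∫⁻ ω, ‖f ω - g ω‖ₑ ^ (2 : ℝ) ∂P
      = eLpNorm (f - g) 2 P ^ (2 : ℝ) := fun f g => by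
    rw [eLpNorm_eq_lintegral_rpow_enorm_toReal (by norm_num) (by norm_num), ← ENNReal.rpow_mul]
    simp
  have key : Tendsto (fun n => ∫⁻ s in Set.Ioc 0 T, ∫⁻ ω, ‖(V n).path s ω - v s ω‖ₑ ^ (2 : ℝ) ∂P)
      atTop (𝓝 0) := by
    have h0 : ∫⁻ s in Set.Ioc 0 T, (0 : ℝ≥0∞) = 0 := by simp
    rw [← h0]
    -- Dominated convergence in s, with the bound (2C)² for the squared difference of two values of
    -- v.
    refine tendsto_lintegral_of_dominated_convergence' (fun _ => ENNReal.ofReal (2 * C) ^ (2 : ℝ))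
      (fun n => (hm n).lintegral_prod_right') (fun n => ?_) ?_ ?_
    · filter_upwards [ae_restrict_mem measurableSet_Ioc] with s hs
      obtain ⟨r, hr, -, hrv⟩ := hpath n s hs
      refine (lintegral_mono (g := fun _ => ENNReal.ofReal (2 * C) ^ (2 : ℝ)) fun ω => ?_).trans
        (by simp)
      refine ENNReal.rpow_le_rpow ?_ (by norm_num)
      rw [hrv ω, Real.enorm_eq_ofReal_abs]
      refine ENNReal.ofReal_le_ofReal ((abs_sub _ _).trans ?_)
      linarith [hC r hr ω, hC s ⟨hs.1.le, hs.2⟩ ω]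
    · simp [ENNReal.mul_eq_top]
    · filter_upwards [ae_restrict_mem measurableSet_Ioc,
        ae_restrict_of_ae (hD.ae_notMem volume)] with s hs hsD
      choose r hr hrs hrv using fun n => hpath n s hs
      have e : ∀ n, ∫⁻ ω, ‖(V n).path s ω - v s ω‖ₑ ^ (2 : ℝ) ∂P =
          eLpNorm (v (r n) - v s) 2 P ^ (2 : ℝ) := fun n => by simp only [hrv, hinner]
      simp only [e]
      have hr' : Tendsto r atTop (𝓝[Set.Icc 0 T] s) := by
        refine tendsto_nhdsWithin_iff.2 ⟨?_, Eventually.of_forall hr⟩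
        rw [tendsto_iff_dist_tendsto_zero]
        refine squeeze_zero (fun _ => dist_nonneg) hrs ?_
        simpa only [Function.comp_def, Nat.cast_add, Nat.cast_one] using
          (tendsto_const_div_atTop_nhds_zero_nat T).comp (tendsto_add_atTop_nat 1)
      have := ((hcont s ⟨⟨hs.1.le, hs.2⟩, hsD⟩).comp hr').ennrpow_const 2
      simpa [Function.comp_def] using this
  have h2 := key.ennrpow_const (2⁻¹)
  rw [ENNReal.zero_rpow_of_pos (by norm_num)] at h2
  refine h2.congr fun n => ?_
  rw [eLpNorm_eq_lintegral_rpow_enorm_toReal (by norm_num) (by norm_num)]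
  simp only [ENNReal.toReal_ofNat, one_div]
  rw [lintegral_prod _ (hm n)]

/-- Evaluating f at the next grid point ⌈s(n+1)⌉/(n+1), clamped to [0, T], uses countably many times
and converges by right continuity. -/
theorem aemeasurable_uncurry_of_rightContinuous {Ω : Type*} [MeasurableSpace Ω] {P : Measure Ω}
    [IsProbabilityMeasure P] {T : ℝ} (hT : 0 ≤ T) {f : ℝ → Ω → ℝ}
    (hf : ∀ t ∈ Set.Icc 0 T, Measurable (f t))
    (hc : ∀ ω, ∀ t ∈ Set.Ico 0 T, ContinuousWithinAt (fun s => f s ω) (Set.Ici t) t) :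
    AEMeasurable (fun p : ℝ × Ω => f p.1 p.2) ((volume.restrict (Set.Ioc 0 T)).prod P) := by
  let c : ℕ → ℤ → ℝ := fun n k => max 0 (min T (k / (n + 1)))
  have hcmem : ∀ n k, c n k ∈ Set.Icc 0 T := fun n k =>
    ⟨le_max_left _ _, max_le hT (min_le_left _ _)⟩
  refine aemeasurable_of_tendsto_metrizable_ae atTop
    (f := fun n (p : ℝ × Ω) => f (c n ⌈p.1 * (n + 1)⌉) p.2) (fun n => ?_) ?_
  · have h1 : Measurable fun p : ℤ × Ω => f (c n p.1) p.2 :=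
      measurable_from_prod_countable_right fun k => hf _ (hcmem n k)
    exact (h1.comp ((Int.measurable_ceil.comp
      (measurable_fst.mul_const _)).prodMk measurable_snd)).aemeasurable
  · filter_upwards [Measure.quasiMeasurePreserving_fst.ae
      (ae_restrict_mem (μ := volume) (measurableSet_Ioc (a := (0 : ℝ)) (b := T)))] with p hp
    obtain ⟨s, ω⟩ := p
    simp only at hp ⊢
    have hle : ∀ n : ℕ, s ≤ c n ⌈s * (n + 1)⌉ := fun n => by
      refine le_max_of_le_right (le_min hp.2 ?_)
      rw [le_div_iff₀ (by positivity)]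
      exact Int.le_ceil _
    -- Right continuity is not available at T, but there the clamped grid point is T itself.
    rcases hp.2.eq_or_lt with rfl | hsT
    · have : ∀ n : ℕ, c n ⌈s * (n + 1)⌉ = s := fun n => le_antisymm (hcmem n _).2 (hle n)
      simp [this]
    · refine (hc ω s ⟨hp.1.le, hsT⟩).tendsto.comp
        (tendsto_nhdsWithin_iff.2 ⟨?_, Eventually.of_forall hle⟩)
      refine tendsto_of_tendsto_of_tendsto_of_le_of_le tendsto_const_nhds
        (h := fun n : ℕ => s + 1 / ((n : ℝ) + 1)) ?_ hle fun n => ?_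
      · simpa using tendsto_const_nhds.add (tendsto_one_div_add_atTop_nhds_zero_nat (𝕜 := ℝ))
      · have hn : (0 : ℝ) < n + 1 := by positivity
        have h0 : 0 < 1 / ((n : ℝ) + 1) := by positivity
        refine max_le (by linarith [hp.1]) ((min_le_right _ _).trans ?_)
        rw [div_le_iff₀ hn, add_mul, one_div_mul_cancel hn.ne']
        exact (Int.ceil_lt_add_one _).le

/-! ### L²-continuity of conditional expectations along a filtration -/

section CondExp

variable {Ω : Type*} {m' m : MeasurableSpace Ω} {P : Measure Ω} [IsProbabilityMeasure P]

theorem integral_mul_condExp_of_memLp (hm : m' ≤ m) {f h : Ω → ℝ} (hf : MemLp f 2 P)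
    (hh : MemLp h 2 P) (hhm : StronglyMeasurable[m'] h) :
    ∫ ω, (P[f | m']) ω * h ω ∂P = ∫ ω, f ω * h ω ∂P := by
  have h1 := condExp_mul_of_stronglyMeasurable_right (m := m') hhm (hf.integrable_mul hh)
    (hf.integrable (by norm_num))
  exact (integral_congr_ae h1).symm.trans (integral_condExp hm)

/-- Pythagoras: the conditional expectation is the orthogonal projection. -/
theorem integral_sub_sq_eq_add (hm : m' ≤ m) {f g : Ω → ℝ} (hf : MemLp f 2 P)
    (hg : MemLp g 2 P) (hgm : StronglyMeasurable[m'] g) :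
    ∫ ω, (f ω - g ω) ^ 2 ∂P =
      ∫ ω, (f ω - (P[f | m']) ω) ^ 2 ∂P + ∫ ω, ((P[f | m']) ω - g ω) ^ 2 ∂P := by
  have hF : MemLp (P[f | m']) 2 P := hf.condExp (by norm_num)
  have hh : MemLp (P[f | m'] - g) 2 P := hF.sub hg
  have h0 := integral_mul_condExp_of_memLp hm hf hh (stronglyMeasurable_condExp.sub hgm)
  have hi1 : Integrable (fun ω => f ω * (P[f | m'] - g) ω) P := hf.integrable_mul hh
  have hi2 : Integrable (fun ω => (P[f | m']) ω * (P[f | m'] - g) ω) P := hF.integrable_mul hh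
  have hi3 : Integrable (fun ω => (f ω - (P[f | m']) ω) ^ 2) P := (hf.sub hF).integrable_sq
  have hi4 : Integrable (fun ω => ((P[f | m']) ω - g ω) ^ 2) P := hh.integrable_sq
  have e : ∀ ω, (f ω - g ω) ^ 2 = ((f ω - (P[f | m']) ω) ^ 2 + ((P[f | m']) ω - g ω) ^ 2) +
      2 * (f ω * (P[f | m'] - g) ω - (P[f | m']) ω * (P[f | m'] - g) ω) := fun ω => by
    simp only [Pi.sub_apply]
    ring
  have hi5 : Integrable (fun ω => f ω * (P[f | m'] - g) ω - (P[f | m']) ω * (P[f | m'] - g) ω) P :=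
    hi1.sub hi2
  simp only [e]
  rw [integral_add (hi3.fun_add hi4) (hi5.const_mul 2), integral_add hi3 hi4,
    integral_const_mul, integral_sub hi1 hi2, h0, sub_self, mul_zero, add_zero]

/-- Orthogonality of martingale increments: Pythagoras for E[f | 𝒢_t] over 𝒢_s with g = 0, and the
tower property. -/
theorem integral_condExp_filtration_sub_sq {𝒢 : Filtration ℝ m} {f : Ω → ℝ} (hf : MemLp f 2 P)
    {s t : ℝ} (hst : s ≤ t) :
    ∫ ω, ((P[f | 𝒢 t]) ω - (P[f | 𝒢 s]) ω) ^ 2 ∂P =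
      ∫ ω, (P[f | 𝒢 t]) ω ^ 2 ∂P - ∫ ω, (P[f | 𝒢 s]) ω ^ 2 ∂P := by
  have h := integral_sub_sq_eq_add (𝒢.le s) (f := P[f | 𝒢 t]) (g := 0) (hf.condExp (by norm_num))
    MemLp.zero stronglyMeasurable_zero
  have ht := condExp_condExp_of_le (μ := P) (f := f) (𝒢.mono hst) (𝒢.le t)
  have e1 : ∫ ω, ((P[f | 𝒢 t]) ω - (P[P[f | 𝒢 t] | 𝒢 s]) ω) ^ 2 ∂P =
      ∫ ω, ((P[f | 𝒢 t]) ω - (P[f | 𝒢 s]) ω) ^ 2 ∂P :=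
    integral_congr_ae (by filter_upwards [ht] with ω hω; rw [hω])
  have e2 : ∫ ω, (P[P[f | 𝒢 t] | 𝒢 s]) ω ^ 2 ∂P = ∫ ω, (P[f | 𝒢 s]) ω ^ 2 ∂P :=
    integral_congr_ae (by filter_upwards [ht] with ω hω; rw [hω])
  simp only [Pi.zero_apply, sub_zero] at h
  rw [e1, e2] at h
  linarith

/-- A closed martingale is `L²`-continuous off a countable set of times. -/
theorem exists_countable_tendsto_eLpNorm_condExp_sub (𝒢 : Filtration ℝ m) {f : Ω → ℝ}
    (hf : MemLp f 2 P) :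
    ∃ D : Set ℝ, D.Countable ∧ ∀ t, t ∉ D →
      Tendsto (fun s => eLpNorm (P[f | 𝒢 s] - P[f | 𝒢 t]) 2 P) (𝓝 t) (𝓝 0) := by
  let φ : ℝ → ℝ := fun t => ∫ ω, (P[f | 𝒢 t]) ω ^ 2 ∂P
  have hφ : Monotone φ := fun s t hst => by
    have h := integral_condExp_filtration_sub_sq (𝒢 := 𝒢) hf hst
    have h0 : 0 ≤ ∫ ω, ((P[f | 𝒢 t]) ω - (P[f | 𝒢 s]) ω) ^ 2 ∂P :=
      integral_nonneg fun _ => sq_nonneg _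
    simp only [φ]
    linarith
  refine ⟨_, hφ.countable_not_continuousAt, fun t ht => ?_⟩
  have hc : ContinuousAt φ t := not_not.1 ht
  have hF : ∀ s, MemLp (P[f | 𝒢 s]) 2 P := fun s => hf.condExp (by norm_num)
  have e : ∀ s, eLpNorm (P[f | 𝒢 s] - P[f | 𝒢 t]) 2 P = ENNReal.ofReal √|φ s - φ t| := fun s => by
    rcases le_total s t with hst | hst
    · rw [eLpNorm_sub_comm, eLpNorm_two_eq_ofReal_sqrt_integral_sq ((hF t).sub (hF s)), abs_sub_comm,
        abs_of_nonneg (sub_nonneg.2 (hφ hst))]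
      exact congrArg (fun x => ENNReal.ofReal √x) (integral_condExp_filtration_sub_sq hf hst)
    · rw [eLpNorm_two_eq_ofReal_sqrt_integral_sq ((hF s).sub (hF t)),
        abs_of_nonneg (sub_nonneg.2 (hφ hst))]
      exact congrArg (fun x => ENNReal.ofReal √x) (integral_condExp_filtration_sub_sq hf hst)
  simp only [e]
  have h2 : Tendsto (fun s => √|φ s - φ t|) (𝓝 t) (𝓝 0) := by
    have := ((hc.sub_const (φ t)).abs.sqrt)
    simpa [ContinuousAt] using this
  simpa using ENNReal.tendsto_ofReal h2

/-- If `Z` is uniformly `L²`-continuous on `[0, T]`, then `t ↦ E[Z_t | 𝒢_t]` is `L²`-continuous off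
a countable set of times. -/
theorem exists_countable_tendsto_eLpNorm_optional_sub (𝒢 : Filtration ℝ m) {T : ℝ} (hT : 0 < T)
    {Z : ℝ → Ω → ℝ} (hZ : ∀ t ∈ Set.Icc 0 T, MemLp (Z t) 2 P) {ρ : ℝ → ℝ≥0∞}
    (hρ : Tendsto ρ (𝓝 0) (𝓝 0))
    (hρZ : ∀ s ∈ Set.Icc 0 T, ∀ t ∈ Set.Icc 0 T, eLpNorm (Z s - Z t) 2 P ≤ ρ (s - t)) :
    ∃ D : Set ℝ, D.Countable ∧ ∀ t ∈ Set.Icc 0 T \ D,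
      Tendsto (fun s => eLpNorm (P[Z s | 𝒢 s] - P[Z t | 𝒢 t]) 2 P) (𝓝[Set.Icc 0 T] t) (𝓝 0) := by
  have hex : ∀ q : ℚ, ∃ D : Set ℝ, D.Countable ∧ ((q : ℝ) ∈ Set.Icc 0 T → ∀ t, t ∉ D →
      Tendsto (fun s => eLpNorm (P[Z q | 𝒢 s] - P[Z q | 𝒢 t]) 2 P) (𝓝 t) (𝓝 0)) := fun q => by
    by_cases hq : (q : ℝ) ∈ Set.Icc 0 T
    · obtain ⟨D, hD, h⟩ := exists_countable_tendsto_eLpNorm_condExp_sub 𝒢 (hZ q hq)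
      exact ⟨D, hD, fun _ => h⟩
    · exact ⟨∅, Set.countable_empty, fun h => absurd h hq⟩
  choose D hD hDt using hex
  refine ⟨⋃ q, D q, Set.countable_iUnion hD, fun t ht => ?_⟩
  -- With the σ-algebra fixed, conditional expectation is an L²-contraction, so the modulus of Z
  -- survives uniformly in u.
  have hle : ∀ s ∈ Set.Icc 0 T, ∀ q ∈ Set.Icc 0 T, ∀ u,
      eLpNorm (P[Z s | 𝒢 u] - P[Z q | 𝒢 u]) 2 P ≤ ρ (s - q) := fun s hs q hq u => by
    rw [← eLpNorm_congr_ae (condExp_sub ((hZ s hs).integrable (by norm_num))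
      ((hZ q hq).integrable (by norm_num)) (𝒢 u))]
    exact (eLpNorm_condExp_le_eLpNorm _ (by norm_num)).trans (hρZ s hs q hq)
  have hm : ∀ s u, AEStronglyMeasurable (P[Z s | 𝒢 u]) P := fun s u =>
    (stronglyMeasurable_condExp.mono (𝒢.le u)).aestronglyMeasurable
  rw [ENNReal.tendsto_nhds_zero]
  intro ε hε
  have hε3 : 0 < ε / 3 := ENNReal.div_pos hε.ne' (by norm_num)
  have hρε := (ENNReal.tendsto_nhds_zero.1 hρ) (ε / 3) hε3
  obtain ⟨δ, hδ, hball⟩ := Metric.eventually_nhds_iff.1 hρε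
  obtain ⟨q, hq, hqt⟩ : ∃ q : ℚ, (q : ℝ) ∈ Set.Icc 0 T ∧ |(q : ℝ) - t| < δ / 2 := by
    obtain ⟨q, h1, h2⟩ := exists_rat_btwn (show max 0 (t - δ / 2) < min T (t + δ / 2) from
      max_lt (lt_min hT (by linarith [ht.1.1])) (lt_min (by linarith [ht.1.2]) (by linarith)))
    have h3 := max_lt_iff.1 h1
    have h4 := lt_min_iff.1 h2
    exact ⟨q, ⟨h3.1.le, h4.1.le⟩, abs_lt.2 ⟨by linarith, by linarith⟩⟩
  have hmart := ENNReal.tendsto_nhds_zero.1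
    (hDt q hq t fun h => ht.2 (Set.mem_iUnion.2 ⟨q, h⟩)) (ε / 3) hε3
  filter_upwards [nhdsWithin_le_nhds hmart, self_mem_nhdsWithin,
    nhdsWithin_le_nhds (Metric.ball_mem_nhds t (half_pos hδ))] with s hs1 hsI hsb
  rw [Metric.mem_ball, Real.dist_eq] at hsb
  have hqt' := abs_lt.1 hqt
  have hsb' := abs_lt.1 hsb
  have h1 : eLpNorm (P[Z s | 𝒢 s] - P[Z q | 𝒢 s]) 2 P ≤ ε / 3 :=
    (hle s hsI q hq s).trans (hball (by rw [Real.dist_eq, sub_zero, abs_lt]; constructor <;> linarith))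
  have h3 : eLpNorm (P[Z q | 𝒢 t] - P[Z t | 𝒢 t]) 2 P ≤ ε / 3 :=
    (hle q hq t ht.1 t).trans
      (hball (by rw [Real.dist_eq, sub_zero, abs_lt]; constructor <;> linarith))
  -- Replace Z_s by Z_q, move the σ-algebra from 𝒢_s to 𝒢_t, then replace Z_q by Z_t; each move
  -- costs at most ε/3.
  have e : P[Z s | 𝒢 s] - P[Z t | 𝒢 t] = (P[Z s | 𝒢 s] - P[Z q | 𝒢 s]) +
      (P[Z q | 𝒢 s] - P[Z q | 𝒢 t]) + (P[Z q | 𝒢 t] - P[Z t | 𝒢 t]) := by abel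
  rw [e]
  calc _ ≤ eLpNorm (P[Z s | 𝒢 s] - P[Z q | 𝒢 s]) 2 P +
        eLpNorm (P[Z q | 𝒢 s] - P[Z q | 𝒢 t]) 2 P + eLpNorm (P[Z q | 𝒢 t] - P[Z t | 𝒢 t]) 2 P :=
        (eLpNorm_add_le (((hm _ _).sub (hm _ _)).add ((hm _ _).sub (hm _ _)))
          ((hm _ _).sub (hm _ _)) (by norm_num)).trans (add_le_add_left
            (eLpNorm_add_le ((hm _ _).sub (hm _ _)) ((hm _ _).sub (hm _ _)) (by norm_num)) _)
    _ ≤ ε / 3 + ε / 3 + ε / 3 := add_le_add (add_le_add h1 hs1) h3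
    _ = ε := ENNReal.add_thirds ε

end CondExp

/-! ### L²-continuity of the Markov chain and the optimal volatility -/

theorem Matrix.continuous_exp_smul {d : ℕ} (Q : Matrix (Fin d) (Fin d) ℝ) :
    Continuous fun h : ℝ => NormedSpace.exp (h • Q) := by
  -- The norm is auxiliary: neither the exponential nor the topology depends on it.
  let _ : NormedRing (Matrix (Fin d) (Fin d) ℝ) := Matrix.linftyOpNormedRing
  let _ : NormedAlgebra ℝ (Matrix (Fin d) (Fin d) ℝ) := Matrix.linftyOpNormedAlgebra
  let _ : NormedAlgebra ℚ (Matrix (Fin d) (Fin d) ℝ) := NormedAlgebra.restrictScalars ℚ ℝ _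
  have h : Continuous (NormedSpace.exp : Matrix (Fin d) (Fin d) ℝ → Matrix (Fin d) (Fin d) ℝ) :=
    NormedSpace.exp_continuous
  exact h.comp (continuous_id.smul continuous_const)

theorem dotProduct_condExp {Ω : Type*} {m' m : MeasurableSpace Ω} {P : Measure Ω} {d : ℕ}
    {f : Ω → Fin d → ℝ} (hf : Integrable f P) (σ : Fin d → ℝ) :
    (fun ω => σ ⬝ᵥ (P[f | m']) ω) =ᵐ[P] P[fun ω => σ ⬝ᵥ f ω | m'] := by
  let L : (Fin d → ℝ) →L[ℝ] ℝ := ∑ i, σ i • ContinuousLinearMap.proj (R := ℝ) i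
  have hL : ∀ x, L x = σ ⬝ᵥ x := fun x => by simp [L, dotProduct]
  have h := L.comp_condExp_comm (m := m') hf
  have e1 : L ∘ P[f | m'] = fun ω => σ ⬝ᵥ (P[f | m']) ω := funext fun ω => hL _
  have e2 : L ∘ f = fun ω => σ ⬝ᵥ f ω := funext fun ω => hL _
  rwa [e1, e2] at h

namespace IsStationaryMarkovChain

variable {Ω : Type*} [m : MeasurableSpace Ω] {P : Measure Ω} [IsProbabilityMeasure P] {T : ℝ}
  {d : ℕ} {Q : Matrix (Fin d) (Fin d) ℝ} {Y : ℝ → Ω → Fin d → ℝ}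

theorem measurable_coord (hY : IsStationaryMarkovChain P T Q Y) {t : ℝ} (ht : t ∈ Set.Icc 0 T)
    (i : Fin d) : Measurable fun ω => Y t ω i :=
  (measurable_pi_apply i).comp (hY.measurable t ht)

theorem coord_eq_zero_or_one (hY : IsStationaryMarkovChain P T Q Y) {t : ℝ}
    (ht : t ∈ Set.Icc 0 T) (ω : Ω) (i : Fin d) : Y t ω i = 0 ∨ Y t ω i = 1 := by
  obtain ⟨j, hj⟩ := hY.unit_vector t ht ω
  rw [hj, Pi.single_apply]
  split_ifs <;> simp

theorem abs_coord_le_one (hY : IsStationaryMarkovChain P T Q Y) {t : ℝ}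
    (ht : t ∈ Set.Icc 0 T) (ω : Ω) (i : Fin d) : |Y t ω i| ≤ 1 := by
  rcases hY.coord_eq_zero_or_one ht ω i with h | h <;> simp [h]

theorem sum_coord (hY : IsStationaryMarkovChain P T Q Y) {t : ℝ}
    (ht : t ∈ Set.Icc 0 T) (ω : Ω) : ∑ i, Y t ω i = 1 := by
  obtain ⟨j, hj⟩ := hY.unit_vector t ht ω
  simp [hj]

theorem memLp_coord (hY : IsStationaryMarkovChain P T Q Y) {t : ℝ} (ht : t ∈ Set.Icc 0 T)
    (i : Fin d) : MemLp (fun ω => Y t ω i) 2 P :=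
  MemLp.of_bound (hY.measurable_coord ht i).aestronglyMeasurable 1
    (ae_of_all _ fun ω => hY.abs_coord_le_one ht ω i)

theorem integrable (hY : IsStationaryMarkovChain P T Q Y) {t : ℝ} (ht : t ∈ Set.Icc 0 T) :
    Integrable (Y t) P :=
  Integrable.of_eval fun i => (hY.memLp_coord ht i).integrable (by norm_num)

theorem abs_dotProduct_le (hY : IsStationaryMarkovChain P T Q Y) {t : ℝ} (ht : t ∈ Set.Icc 0 T)
    (σ : Fin d → ℝ) (ω : Ω) : |σ ⬝ᵥ Y t ω| ≤ ∑ i, |σ i| := by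
  refine (Finset.abs_sum_le_sum_abs _ _).trans (Finset.sum_le_sum fun i _ => ?_)
  rw [abs_mul]
  exact mul_le_of_le_one_right (abs_nonneg _) (hY.abs_coord_le_one ht ω i)

theorem measurable_dotProduct (hY : IsStationaryMarkovChain P T Q Y) {t : ℝ}
    (ht : t ∈ Set.Icc 0 T) (σ : Fin d → ℝ) : Measurable fun ω => σ ⬝ᵥ Y t ω :=
  Finset.measurable_sum _ fun i _ => (hY.measurable_coord ht i).const_mul (σ i)

theorem memLp_dotProduct (hY : IsStationaryMarkovChain P T Q Y) {t : ℝ} (ht : t ∈ Set.Icc 0 T)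
    (σ : Fin d → ℝ) : MemLp (fun ω => σ ⬝ᵥ Y t ω) 2 P :=
  MemLp.of_bound (hY.measurable_dotProduct ht σ).aestronglyMeasurable _
    (ae_of_all _ fun ω => hY.abs_dotProduct_le ht σ ω)

/-- The information generated by `Y` up to time `s`. -/
@[reducible] def past {Ω : Type*} {d : ℕ} (Y : ℝ → Ω → Fin d → ℝ) (s : ℝ) : MeasurableSpace Ω :=
  ⨆ r ∈ Set.Icc 0 s, MeasurableSpace.comap (Y r) inferInstance

/-- Condition on the past of Y up to s: on {Y_s = e_i} the chance of Y_t = e_i is the diagonal entry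
of the transition matrix. -/
theorem integral_coord_mul_coord (hY : IsStationaryMarkovChain P T Q Y) {s t : ℝ} (h0 : 0 ≤ s)
    (hst : s ≤ t) (hT : t ≤ T) (i : Fin d) :
    ∫ ω, Y t ω i * Y s ω i ∂P = NormedSpace.exp ((t - s) • Q) i i * ∫ ω, Y s ω i ∂P := by
  have hs : s ∈ Set.Icc 0 T := ⟨h0, hst.trans hT⟩
  have ht : t ∈ Set.Icc 0 T := ⟨h0.trans hst, hT⟩
  have hle : past Y s ≤ m := iSup₂_le fun r hr => (hY.measurable r ⟨hr.1, hr.2.trans hs.2⟩).comap_le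
  have hYs : Measurable[past Y s] (Y s) := (comap_measurable (Y s)).mono
    (le_iSup₂_of_le (f := fun r (_ : r ∈ Set.Icc 0 s) =>
      MeasurableSpace.comap (Y r) inferInstance) s ⟨h0, le_rfl⟩ le_rfl) le_rfl
  have hYsi : StronglyMeasurable[past Y s] fun ω => Y s ω i :=
    ((measurable_pi_apply i).comp hYs).stronglyMeasurable
  have hmarkov : P[Y t | past Y s] =ᵐ[P] fun ω => Y s ω ᵥ* NormedSpace.exp ((t - s) • Q) :=
    hY.markov s t h0 hst hT
  have hcoord := (ContinuousLinearMap.proj (R := ℝ) (φ := fun _ : Fin d => ℝ) i).comp_condExp_comm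
    (m := past Y s) (hY.integrable ht)
  rw [← integral_mul_condExp_of_memLp hle (hY.memLp_coord ht i) (hY.memLp_coord hs i) hYsi,
    ← integral_const_mul]
  refine integral_congr_ae ?_
  filter_upwards [hmarkov, hcoord] with ω h1 h2
  have h3 : (P[fun ω => Y t ω i | past Y s]) ω = (P[Y t | past Y s]) ω i := h2.symm
  rw [h3, h1]
  obtain ⟨j, hj⟩ := hY.unit_vector s hs ω
  rw [hj, Matrix.single_one_vecMul, Pi.single_apply]
  split_ifs with hij
  · rw [hij]; rfl
  · simp

theorem integral_sum_sub_sq_le (hY : IsStationaryMarkovChain P T Q Y) {s t : ℝ} (h0 : 0 ≤ s)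
    (hst : s ≤ t) (hT : t ≤ T) :
    ∫ ω, ∑ i, (Y t ω i - Y s ω i) ^ 2 ∂P ≤
      ∑ i, 2 * |1 - NormedSpace.exp ((t - s) • Q) i i| := by
  have hs : s ∈ Set.Icc 0 T := ⟨h0, hst.trans hT⟩
  have ht : t ∈ Set.Icc 0 T := ⟨h0.trans hst, hT⟩
  have e : ∀ ω, ∑ i, (Y t ω i - Y s ω i) ^ 2 = ∑ i, 2 * (Y s ω i - Y t ω i * Y s ω i) := fun ω => by
    -- An identity for numbers in {0, 1}; its last term sums to zero over i because the coordinates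
    -- of each state sum to 1.
    have h1 : ∀ i, (Y t ω i - Y s ω i) ^ 2 =
        2 * (Y s ω i - Y t ω i * Y s ω i) + (Y t ω i - Y s ω i) := fun i => by
      rcases hY.coord_eq_zero_or_one hs ω i with h | h <;>
        rcases hY.coord_eq_zero_or_one ht ω i with h' | h' <;> rw [h, h'] <;> norm_num
    rw [Finset.sum_congr rfl fun i _ => h1 i, Finset.sum_add_distrib, Finset.sum_sub_distrib,
      hY.sum_coord hs, hY.sum_coord ht, sub_self, add_zero]
  have hi1 : ∀ i, Integrable (fun ω => Y s ω i) P := fun i =>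
    (hY.memLp_coord hs i).integrable (by norm_num)
  have hi2 : ∀ i, Integrable (fun ω => Y t ω i * Y s ω i) P := fun i =>
    (hY.memLp_coord ht i).integrable_mul (hY.memLp_coord hs i)
  have hi3 : ∀ i, Integrable (fun ω => Y s ω i - Y t ω i * Y s ω i) P := fun i =>
    (hi1 i).sub (hi2 i)
  simp only [e]
  rw [integral_finsetSum _ fun i _ => (hi3 i).const_mul 2]
  refine Finset.sum_le_sum fun i _ => ?_
  rw [integral_const_mul, integral_sub (hi1 i) (hi2 i), hY.integral_coord_mul_coord h0 hst hT]
  have hp0 : 0 ≤ ∫ ω, Y s ω i ∂P := integral_nonneg fun ω => by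
    rcases hY.coord_eq_zero_or_one hs ω i with h | h <;> simp [h]
  have hp1 : ∫ ω, Y s ω i ∂P ≤ 1 := by
    have := integral_mono (hi1 i) (integrable_const (1 : ℝ)) fun ω =>
      (le_abs_self _).trans (hY.abs_coord_le_one hs ω i)
    simpa using this
  gcongr
  calc _ = (1 - NormedSpace.exp ((t - s) • Q) i i) * ∫ ω, Y s ω i ∂P := by ring
    _ ≤ |1 - NormedSpace.exp ((t - s) • Q) i i| * ∫ ω, Y s ω i ∂P := by
      gcongr
      exact le_abs_self _
    _ ≤ _ := mul_le_of_le_one_right (abs_nonneg _) hp1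

/-- A modulus of continuity in `L²` for `σ ⬝ᵥ Y`. -/
theorem exists_modulus (hY : IsStationaryMarkovChain P T Q Y) (σ : Fin d → ℝ) :
    ∃ ρ : ℝ → ℝ≥0∞, Tendsto ρ (𝓝 0) (𝓝 0) ∧ ∀ s ∈ Set.Icc 0 T, ∀ t ∈ Set.Icc 0 T,
      eLpNorm ((fun ω => σ ⬝ᵥ Y s ω) - fun ω => σ ⬝ᵥ Y t ω) 2 P ≤ ρ (s - t) := by
  -- The factor ∑ σ_i² comes from Cauchy–Schwarz; |h| makes the modulus symmetric in s and t.
  let ρ : ℝ → ℝ≥0∞ := fun h => ENNReal.ofReal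
    √((∑ i, σ i ^ 2) * ∑ i, 2 * |1 - NormedSpace.exp (|h| • Q) i i|)
  refine ⟨ρ, ?_, fun s hs t ht => ?_⟩
  · have hexp : Continuous fun h : ℝ => NormedSpace.exp (|h| • Q) :=
      (Matrix.continuous_exp_smul Q).comp continuous_abs
    have hc : Continuous ρ := by
      refine ENNReal.continuous_ofReal.comp (Real.continuous_sqrt.comp (continuous_const.mul
        (continuous_finsetSum _ fun i _ => continuous_const.mul
          (continuous_const.sub (hexp.matrix_elem i i)).abs)))
    have := hc.tendsto 0
    simpa [ρ] using this
  · wlog hts : t ≤ s generalizing s t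
    · have := this t ht s hs (le_of_not_ge hts)
      rw [eLpNorm_sub_comm]
      refine this.trans_eq ?_
      simp only [ρ, abs_sub_comm]
    · rw [eLpNorm_two_eq_ofReal_sqrt_integral_sq
        ((hY.memLp_dotProduct hs σ).sub (hY.memLp_dotProduct ht σ))]
      refine ENNReal.ofReal_le_ofReal (Real.sqrt_le_sqrt ?_)
      rw [abs_of_nonneg (sub_nonneg.2 hts)]
      refine le_trans ?_ (mul_le_mul_of_nonneg_left (hY.integral_sum_sub_sq_le ht.1 hts hs.2)
        (Finset.sum_nonneg fun i _ => sq_nonneg _))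
      rw [← integral_const_mul]
      refine integral_mono
        ((hY.memLp_dotProduct hs σ).sub (hY.memLp_dotProduct ht σ)).integrable_sq
        ((integrable_finsetSum _ fun i _ =>
          ((hY.memLp_coord hs i).sub (hY.memLp_coord ht i)).integrable_sq).const_mul _) fun ω => ?_
      simp only [Pi.sub_apply, ← dotProduct_sub]
      exact Finset.sum_mul_sq_le_sq_mul_sq _ _ _

theorem tendsto_eLpNorm_dotProduct_sub (hY : IsStationaryMarkovChain P T Q Y) (σ : Fin d → ℝ)
    {t : ℝ} (ht : t ∈ Set.Icc 0 T) :
    Tendsto (fun s => eLpNorm ((fun ω => σ ⬝ᵥ Y s ω) - fun ω => σ ⬝ᵥ Y t ω) 2 P)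
      (𝓝[Set.Icc 0 T] t) (𝓝 0) := by
  obtain ⟨ρ, hρ, h⟩ := hY.exists_modulus σ
  have h1 : Tendsto (fun s => ρ (s - t)) (𝓝 t) (𝓝 0) :=
    hρ.comp (tendsto_sub_nhds_zero_iff.2 tendsto_id)
  refine tendsto_of_tendsto_of_tendsto_of_le_of_le' tendsto_const_nhds
    (h1.mono_left nhdsWithin_le_nhds) (Eventually.of_forall fun _ => bot_le) ?_
  filter_upwards [self_mem_nhdsWithin] with s hs using h s hs t ht

theorem aemeasurable_uncurry_dotProduct (hY : IsStationaryMarkovChain P T Q Y) (hT : 0 ≤ T)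
    (σ : Fin d → ℝ) : AEMeasurable (fun p : ℝ × Ω => σ ⬝ᵥ Y p.1 p.2)
      ((volume.restrict (Set.Ioc 0 T)).prod P) :=
  aemeasurable_uncurry_of_rightContinuous hT (f := fun t ω => σ ⬝ᵥ Y t ω)
    (fun t ht => hY.measurable_dotProduct ht σ) fun ω t ht =>
    tendsto_finsetSum _ fun i _ => ((continuous_apply i).continuousAt.comp_continuousWithinAt
      (hY.right_continuous ω t ht)).tendsto.const_mul (σ i)

theorem itoIntegrable_dotProduct (hY : IsStationaryMarkovChain P T Q Y) (hT : 0 < T)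
    {𝓕 : Filtration ℝ m} (hY𝓕 : ∀ t ∈ Set.Icc 0 T, Measurable[𝓕 t] (Y t)) (σ : Fin d → ℝ) :
    ItoIntegrable P 𝓕 (fun s ω => σ ⬝ᵥ Y s ω) T :=
  itoIntegrable_of_tendsto_eLpNorm hT (v := fun s ω => σ ⬝ᵥ Y s ω) (C := ∑ i, |σ i|)
    (fun t ht => Finset.measurable_sum (m := 𝓕 t) _ fun i _ =>
      ((measurable_pi_apply i).comp (hY𝓕 t ht)).const_mul (σ i))
    (fun _ ht ω => hY.abs_dotProduct_le ht σ ω)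
    (hY.aemeasurable_uncurry_dotProduct hT.le σ) Set.countable_empty
    fun _ ht => hY.tendsto_eLpNorm_dotProduct_sub σ ht.1

/-- The optimal volatility exists as an admissible process. -/
theorem exists_isAdmissibleVolatility (hY : IsStationaryMarkovChain P T Q Y) (hT : 0 < T)
    {𝓕 𝒢 : Filtration ℝ m} (h𝒢 : ∀ t ∈ Set.Icc 0 T, 𝒢 t ≤ 𝓕 t) (σ : Fin d → ℝ) :
    ∃ v : ℝ → Ω → ℝ, IsAdmissibleVolatility P T 𝓕 𝒢 v ∧
      ∀ t ∈ Set.Icc 0 T, v t =ᵐ[P] P[fun ω => σ ⬝ᵥ Y t ω | 𝒢 t] := by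
  set C : ℝ := ∑ i, |σ i|
  have hC0 : 0 ≤ C := Finset.sum_nonneg fun i _ => abs_nonneg _
  obtain ⟨ρ, hρ, hρZ⟩ := hY.exists_modulus σ
  obtain ⟨D, hD, hDt⟩ := exists_countable_tendsto_eLpNorm_optional_sub (P := P) 𝒢 hT
    (Z := fun t ω => σ ⬝ᵥ Y t ω) (fun t ht => hY.memLp_dotProduct ht σ) hρ hρZ
  -- The conditional expectation obeys the bound C only almost surely; the clamp makes it hold
  -- everywhere.
  let X : ℝ → Ω → ℝ := fun t ω => max (-C) (min C ((P[fun ω => σ ⬝ᵥ Y t ω | 𝒢 t]) ω))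
  have hXm : ∀ t, Measurable[𝒢 t] (X t) := fun t =>
    Measurable.max (mδ := 𝒢 t) measurable_const
      (Measurable.min (mδ := 𝒢 t) measurable_const stronglyMeasurable_condExp.measurable)
  have hXC : ∀ t ω, |X t ω| ≤ C := fun t ω =>
    abs_le.2 ⟨le_max_left _ _, max_le (by linarith) (min_le_left _ _)⟩
  have hXe : ∀ t ∈ Set.Icc 0 T, X t =ᵐ[P] P[fun ω => σ ⬝ᵥ Y t ω | 𝒢 t] := fun t ht => by
    filter_upwards [ae_bdd_abs_condExp_of_ae_bdd_abs (m := 𝒢 t) (μ := P)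
      (ae_of_all P fun ω => hY.abs_dotProduct_le ht σ ω)] with ω hω
    have hb := abs_le.1 hω
    simp only [X]
    rw [min_eq_right hb.2, max_eq_right hb.1]
  -- L²-continuity concerns almost sure classes only, so it holds for every modification; it serves
  -- for X and again for v.
  have hcont : ∀ Z : ℝ → Ω → ℝ, (∀ t ∈ Set.Icc 0 T, Z t =ᵐ[P] P[fun ω => σ ⬝ᵥ Y t ω | 𝒢 t]) →
      ∀ t ∈ Set.Icc 0 T \ D,
      Tendsto (fun s => eLpNorm (Z s - Z t) 2 P) (𝓝[Set.Icc 0 T] t) (𝓝 0) := fun Z hZ t ht => by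
    refine (hDt t ht).congr' ?_
    filter_upwards [self_mem_nhdsWithin] with s hs
    exact eLpNorm_congr_ae ((hZ s hs).sub (hZ t ht.1)).symm
  obtain ⟨v, hvm, hv𝒢, hvX, hvC⟩ := exists_measurable_adapted_modification (P := P) (X := X)
    (fun _ _ => hXm _) (fun t => (hXm t).mono (𝒢.le t) le_rfl) hXC hD (hcont X hXe)
  have hve : ∀ t ∈ Set.Icc 0 T, v t =ᵐ[P] P[fun ω => σ ⬝ᵥ Y t ω | 𝒢 t] := fun t ht =>
    (hvX t ht).trans (hXe t ht)
  exact ⟨v, ⟨hvm, hv𝒢, itoIntegrable_of_tendsto_eLpNorm hT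
    (fun t ht => (hv𝒢 t ht).mono (h𝒢 t ht) le_rfl) (fun _ _ => hvC _) hvm.aemeasurable hD
    (hcont v hve)⟩, hve⟩

end IsStationaryMarkovChain

/-! ### Minimization of the mean squared error -/

/-- Pythagoras for processes: the optional projection `u` of `Z` is the closest adapted process. -/
theorem integral_prod_sub_sq_eq_add {Ω : Type*} [m : MeasurableSpace Ω] {P : Measure Ω}
    [IsProbabilityMeasure P] {t : ℝ} {𝒢 : Filtration ℝ m} {Z u v : ℝ → Ω → ℝ}
    (hZ2 : MemLp (fun p : ℝ × Ω => Z p.1 p.2) 2 ((volume.restrict (Set.Ioc 0 t)).prod P))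
    (hu2 : MemLp (fun p : ℝ × Ω => u p.1 p.2) 2 ((volume.restrict (Set.Ioc 0 t)).prod P))
    (hv2 : MemLp (fun p : ℝ × Ω => v p.1 p.2) 2 ((volume.restrict (Set.Ioc 0 t)).prod P))
    (hZ : ∀ s ∈ Set.Ioc 0 t, MemLp (Z s) 2 P)
    (hu : ∀ s ∈ Set.Ioc 0 t, u s =ᵐ[P] P[Z s | 𝒢 s])
    (hv : ∀ s ∈ Set.Ioc 0 t, Measurable[𝒢 s] (v s)) :
    ∫ p : ℝ × Ω, (Z p.1 p.2 - v p.1 p.2) ^ 2 ∂((volume.restrict (Set.Ioc 0 t)).prod P) =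
      ∫ p : ℝ × Ω, (Z p.1 p.2 - u p.1 p.2) ^ 2 ∂((volume.restrict (Set.Ioc 0 t)).prod P) +
      ∫ p : ℝ × Ω, (u p.1 p.2 - v p.1 p.2) ^ 2 ∂((volume.restrict (Set.Ioc 0 t)).prod P) := by
  have h1 := (hZ2.sub hv2).integrable_sq
  have h2 := (hZ2.sub hu2).integrable_sq
  have h3 := (hu2.sub hv2).integrable_sq
  simp only [Pi.sub_apply] at h1 h2 h3
  rw [integral_prod _ h1, integral_prod _ h2, integral_prod _ h3,
    ← integral_add h2.integral_prod_left h3.integral_prod_left]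
  refine integral_congr_ae ?_
  -- By Fubini, v_s is square integrable for almost every s only.
  filter_upwards [ae_restrict_mem measurableSet_Ioc, hv2.integrable_sq.prod_right_ae] with s hs hvs
  have hvsm := hv s hs
  have hvs2 : MemLp (v s) 2 P := (memLp_two_iff_integrable_sq
    (hvsm.mono (𝒢.le s) le_rfl).aestronglyMeasurable).2 hvs
  change ∫ ω, (Z s ω - v s ω) ^ 2 ∂P =
    ∫ ω, (Z s ω - u s ω) ^ 2 ∂P + ∫ ω, (u s ω - v s ω) ^ 2 ∂P
  rw [integral_sub_sq_eq_add (𝒢.le s) (hZ s hs) hvs2 hvsm.stronglyMeasurable]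
  congr 1 <;>
  · refine integral_congr_ae ?_
    filter_upwards [hu s hs] with ω hω
    rw [hω]

theorem mainTheorem2 {Ω : Type*} [m : MeasurableSpace Ω] (P : Measure Ω) [IsProbabilityMeasure P]
    (T : ℝ) (hT : 0 < T) (𝓕 : Filtration ℝ m)
    (W : ℝ → Ω → ℝ) (hW : IsBrownianMotionOn P T 𝓕 W)
    (d : ℕ) (Q : Matrix (Fin d) (Fin d) ℝ) (Y : ℝ → Ω → Fin d → ℝ)
    (hY : IsStationaryMarkovChain P T Q Y) (hY𝓕 : ∀ t ∈ Set.Icc 0 T, Measurable[𝓕 t] (Y t))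
    (μ σ : Fin d → ℝ) (hσ : ∀ i, 0 < σ i)
    (𝒢 : Filtration ℝ m) (h𝒢 : ∀ t ∈ Set.Icc 0 T, 𝒢 t ≤ 𝓕 t) :
    (∃ v : ℝ → Ω → ℝ, IsAdmissibleVolatility P T 𝓕 𝒢 v ∧
      ∀ t ∈ Set.Icc 0 T, v t =ᵐ[P] fun ω => σ ⬝ᵥ (P[Y t | 𝒢 t]) ω) ∧
    ∀ v : ℝ → Ω → ℝ, IsAdmissibleVolatility P T 𝓕 𝒢 v → ∀ t ∈ Set.Icc 0 T,
      ((∀ v' : ℝ → Ω → ℝ, IsAdmissibleVolatility P T 𝓕 𝒢 v' →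
          meanSquaredError P 𝓕 W Y μ σ v t ≤ meanSquaredError P 𝓕 W Y μ σ v' t) ↔
        ∀ᵐ s ∂(volume.restrict (Set.Icc 0 t)), v s =ᵐ[P] fun ω => σ ⬝ᵥ (P[Y s | 𝒢 s]) ω) := by
  obtain ⟨u, hu, hue⟩ := hY.exists_isAdmissibleVolatility hT h𝒢 σ
  have hdot : ∀ t ∈ Set.Icc 0 T,
      (fun ω => σ ⬝ᵥ (P[Y t | 𝒢 t]) ω) =ᵐ[P] P[fun ω => σ ⬝ᵥ Y t ω | 𝒢 t] := fun t ht =>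
    dotProduct_condExp (hY.integrable ht) σ
  refine ⟨⟨u, hu, fun t ht => (hue t ht).trans (hdot t ht).symm⟩, fun v hv t ht => ?_⟩
  have hsub : ∀ s ∈ Set.Ioc 0 t, s ∈ Set.Icc 0 T := fun s hs => ⟨hs.1.le, hs.2.trans ht.2⟩
  have hZi := (hY.itoIntegrable_dotProduct hT hY𝓕 σ).mono ht.2
  have hZm : AEStronglyMeasurable (fun p : ℝ × Ω => σ ⬝ᵥ Y p.1 p.2)
      ((volume.restrict (Set.Ioc 0 t)).prod P) :=
    (hY.aemeasurable_uncurry_dotProduct hT.le σ).aestronglyMeasurable.mono_measure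
      (Measure.prod_mono (Measure.restrict_mono (Set.Ioc_subset_Ioc_right ht.2) le_rfl) le_rfl)
  -- A competitor enters only through its distance to u, so both directions of the equivalence
  -- reduce to the vanishing of that distance for v.
  have hmse : ∀ w, IsAdmissibleVolatility P T 𝓕 𝒢 w → meanSquaredError P 𝓕 W Y μ σ w t =
      meanSquaredError P 𝓕 W Y μ σ u t +
      ∫ p : ℝ × Ω, (u p.1 p.2 - w p.1 p.2) ^ 2 ∂((volume.restrict (Set.Ioc 0 t)).prod P) := by
    intro w hw
    have hwm := hw.measurable.aestronglyMeasurable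
      (μ := (volume.restrict (Set.Ioc 0 t)).prod P)
    have hum := hu.measurable.aestronglyMeasurable
      (μ := (volume.restrict (Set.Ioc 0 t)).prod P)
    have hwi := hw.itoIntegrable.mono ht.2
    have hui := hu.itoIntegrable.mono ht.2
    rw [meanSquaredError_eq hZi hZm hwi hwm hW ht.1 ht.2,
      meanSquaredError_eq hZi hZm hui hum hW ht.1 ht.2]
    exact integral_prod_sub_sq_eq_add (𝒢 := 𝒢) (Z := fun s ω => σ ⬝ᵥ Y s ω) (hZi.memLp hZm)
      (hui.memLp hum) (hwi.memLp hwm) (fun s hs => hY.memLp_dotProduct (hsub s hs) σ)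
      (fun s hs => hue s (hsub s hs)) fun s hs => hw.adapted s (hsub s hs)
  have hint : Integrable (fun p : ℝ × Ω => (u p.1 p.2 - v p.1 p.2) ^ 2)
      ((volume.restrict (Set.Ioc 0 t)).prod P) :=
    (((hu.itoIntegrable.mono ht.2).memLp hu.measurable.aestronglyMeasurable).sub
      ((hv.itoIntegrable.mono ht.2).memLp hv.measurable.aestronglyMeasurable)).integrable_sq
  have hnonneg : ∀ w : ℝ → Ω → ℝ, 0 ≤ ∫ p : ℝ × Ω, (u p.1 p.2 - w p.1 p.2) ^ 2
      ∂((volume.restrict (Set.Ioc 0 t)).prod P) := fun w => integral_nonneg fun _ => sq_nonneg _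
  rw [← Measure.restrict_congr_set (Ioc_ae_eq_Icc (μ := volume) (a := (0 : ℝ)) (b := t))]
  constructor
  · intro hmin
    have h0 := hmin u hu
    rw [hmse v hv] at h0
    have h1 := (integral_eq_zero_iff_of_nonneg (fun _ => sq_nonneg _) hint).1
      (le_antisymm (by linarith) (hnonneg v))
    filter_upwards [Measure.ae_ae_of_ae_prod h1, ae_restrict_mem measurableSet_Ioc] with s hs hsI
    have h2 : v s =ᵐ[P] u s := by
      filter_upwards [hs] with ω hω
      exact (sub_eq_zero.1 (pow_eq_zero_iff two_ne_zero |>.1 hω)).symm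
    exact h2.trans ((hue s (hsub s hsI)).trans (hdot s (hsub s hsI)).symm)
  · intro hae w hw
    have h0 : ∫ p : ℝ × Ω, (u p.1 p.2 - v p.1 p.2) ^ 2
        ∂((volume.restrict (Set.Ioc 0 t)).prod P) = 0 := by
      rw [integral_prod _ hint]
      refine integral_eq_zero_of_ae ?_
      filter_upwards [hae, ae_restrict_mem measurableSet_Ioc] with s hs hsI
      refine integral_eq_zero_of_ae ?_
      filter_upwards [hs, hue s (hsub s hsI), hdot s (hsub s hsI)] with ω h1 h2 h3
      rw [h1, h2, h3]
      simp
    rw [hmse v hv, hmse w hw, h0]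
    linarith [hnonneg w]
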